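/- **Theorem 4.9 (Muir's law).** Let $m,n\ge 0$, $N=m+n$, $[N]=\{1,\dots,N\}$, and work over the field $\mathbb C(q)$. Put $\bar i=0$ if $i\le m$ (even index), $\bar i=1$ if $i>m$ (odd index), and let $\varepsilon(a)\in\{1,0,-1\}$ be the sign of the integer $a$. A matrix $M=(M_{ij})_{i,j\in[N]}$ with entries in a unital associative $\mathbb C(q)$-algebra is a *$q$-super Manin matrix* if for all indices $$M_{ij}^2=0\ \ (\bar i=1,\ \bar j=0),$$ $$M_{ik}M_{il}=q^{\varepsilon(l-k)}(-1)^{(\bar k+1)(\bar l+1)}M_{il}M_{ik}\ \ (\bar i=1),$$ $$M_{ik}M_{jk}=q^{\varepsilon(i-j)}(-1)^{\bar i\bar j}M_{jk}M_{ik}\ \ (\bar k=0),$$ $$M_{ij}M_{kl}-q^{\varepsilon(i-k)+\varepsilon(l-j)}(-1)^{(\bar i+\bar j)(\bar k+\bar l)}M_{kl}M_{ij}=q^{\varepsilon(i-k)}(-1)^{\bar i\bar k+\bar j\bar k+\bar i\bar j}M_{kj}M_{il}-q^{\varepsilon(l-j)}(-1)^{\bar j\bar k+\bar j\bar l+\bar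 k\bar l}M_{il}M_{kj}.$$ For $J\subseteq[N]$ let $M_J=(M_{ij})_{i,j\in J}$. If $J=\{a_1<\dots<a_r<c_1<\dots<c_s\}$ with all $a_t\le m<c_1$ and $M_J$ is invertible, the minor quantum Berezinian is $$\mathrm{Ber}_q(M_J)=\sum_{\sigma\in\mathfrak S_r}(-q)^{-l(\sigma)}M_{a_{\sigma(1)}a_1}\cdots M_{a_{\sigma(r)}a_r}\cdot\sum_{\rho\in\mathfrak S_s}(-q)^{-l(\rho)}(M_J^{-1})_{c_1c_{\rho(1)}}\cdots(M_J^{-1})_{c_sc_{\rho(s)}},$$ where $l$ is the number of inversions (so $\mathrm{Ber}_q(M_\emptyset)=1$). Let $\mathcal A_{m|n}$ be the universal $\mathbb C(q)$-algebra generated by the entries of a $q$-super Manin matrix $\mathbf M$ (the generic matrix) and the entries of two-sided inverses of all its principal submatrices $\mathbf M_J$, $J\subseteq[N]$. Let $I\subseteq[m+n]\setminus[m]$ and $I^c=[m+n]\setminus I$. Let $b_1,\dots,b_k\in\mathbb C(q)$ and $I_{ij}\subseteq I$ ($1\le i\le k$, $1\le j\le m_i$), and suppose that $$\sum_{i=1}^k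 b_i\prod_{j=1}^{m_i}\mathrm{Ber}_q(\mathbf M_{I_{ij}})=0$$ is a minor identity, that is, it holds in $\mathcal A_{m|n}$ for the generic matrix. Then for every $q$-super Manin matrix $M$ with entries in a $\mathbb C(q)$-algebra all of whose principal submatrices are invertible (in particular for $M=\mathbf M$), the element $\mathrm{Ber}_q(M_{I^c})$ is invertible and $$\sum_{i=1}^k b_i\prod_{j=1}^{m_i}\Bigl(\mathrm{Ber}_q(M_{I_{ij}\cup I^c})\,\mathrm{Ber}_q(M_{I^c})^{-1}\Bigr)=0.$$ All products over $j$ are taken in the order $j=1,\dots,m_i$ from left to right. -/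

import Mathlib

namespace QSuper

/-- The symbol `ε(i - j)`: it is `1`, `0`, `-1` according as `i > j`, `i = j`, `i < j`. -/
def eps {ι : Type*} [LinearOrder ι] (i j : ι) : ℤ :=
  if j < i then 1 else if i < j then -1 else 0

/-- The length (number of inversions) of a permutation of a finite linearly ordered set. -/
def permLength {α : Type*} [LinearOrder α] [Fintype α] (σ : Equiv.Perm α) : ℕ :=
  (Finset.univ.filter fun x : α × α => x.1 < x.2 ∧ σ x.2 < σ x.1).card

/-- The product of the `f a`, taken in increasing order of `a` from left to right. -/
def orderedProd {α A : Type*} [LinearOrder α] [Fintype α] [Monoid A] (f : α → A) : A :=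
  (((Finset.univ : Finset α).sort (· ≤ ·)).map f).prod

/-- The parity of an index as a number: `0` if it is even, `1` if it is odd. -/
def par {ι : Type*} (odd : ι → Bool) (i : ι) : ℕ := (odd i).toNat

/-- The quadratic relations of a `q`-super Manin matrix. Rows and columns are indexed by the
linearly ordered set `ι`; the index `i` is odd when `odd i = true` and even otherwise. -/
structure IsQSuperManin {ι K A : Type*} [LinearOrder ι] [Field K] [Ring A] [Algebra K A]
    (q : K) (odd : ι → Bool) (M : Matrix ι ι A) : Prop where
  sq_eq_zero : ∀ i j, odd i = true → odd j = false → M i j * M i j = 0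
  row : ∀ i k l, odd i = true →
    M i k * M i l =
      (q ^ eps l k * (-1) ^ ((par odd k + 1) * (par odd l + 1))) • (M i l * M i k)
  col : ∀ i j k, odd k = false →
    M i k * M j k = (q ^ eps i j * (-1) ^ (par odd i * par odd j)) • (M j k * M i k)
  cross : ∀ i j k l,
    M i j * M k l
        - (q ^ (eps i k + eps l j) *
            (-1) ^ ((par odd i + par odd j) * (par odd k + par odd l))) • (M k l * M i j) =
      (q ^ eps i k *
          (-1) ^ (par odd i * par odd k + par odd j * par odd k + par odd i * par odd j)) •
          (M k j * M i l)
        - (q ^ eps l j *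
            (-1) ^ (par odd j * par odd k + par odd j * par odd l + par odd k * par odd l)) •
          (M i l * M k j)

/-- The principal submatrix `M_J`, with rows and columns in `J` (in increasing order). -/
def principal {ι A : Type*} (M : Matrix ι ι A) (J : Finset ι) : Matrix J J A :=
  M.submatrix Subtype.val Subtype.val

/-- The quantum Berezinian of an invertible matrix `M`:
`∑_σ (-q)^{-l(σ)} M_{σ(1),1} ⋯ M_{σ(m),m} · ∑_ρ (-q)^{-l(ρ)} (M⁻¹)_{m+1,m+ρ(1)} ⋯ (M⁻¹)_{m+n,m+ρ(n)}`,
where `σ` permutes the even indices and `ρ` the odd ones. It is used only for matrices with a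
two-sided inverse over the noncommutative ring `A`, and `Ring.inverse M` is then that inverse. -/
noncomputable def ber {ι K A : Type*} [LinearOrder ι] [Fintype ι] [Field K] [Ring A] [Algebra K A]
    (q : K) (odd : ι → Bool) (M : Matrix ι ι A) : A :=
  (∑ σ : Equiv.Perm {i : ι // odd i = false},
      (-q) ^ (-(permLength σ : ℤ)) •
        orderedProd fun a : {i : ι // odd i = false} => M (σ a).1 a.1) *
  (∑ ρ : Equiv.Perm {i : ι // odd i = true},
      (-q) ^ (-(permLength ρ : ℤ)) •
        orderedProd fun a : {i : ι // odd i = true} => (Ring.inverse M) a.1 (ρ a).1)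

/-- The minor quantum Berezinian `Ber_q(M_J)`. -/
noncomputable def berMinor {ι K A : Type*} [LinearOrder ι] [Field K] [Ring A] [Algebra K A]
    (q : K) (odd : ι → Bool) (M : Matrix ι ι A) (J : Finset ι) : A :=
  ber q (fun i : J => odd i.1) (principal M J)

/-- Generators of the generic algebra: the entries `M_{ij}`, and for each set `J` of indices the
entries of an inverse of the principal submatrix `M_J`. -/
inductive Gen (ι : Type*) : Type _
  | entry (i j : ι) : Gen ι
  | inv (J : Finset ι) (a b : J) : Gen ι

/-- The matrix of the free generators `M_{ij}`. -/
def freeMatrix (ι K : Type*) [Field K] : Matrix ι ι (FreeAlgebra K (Gen ι)) :=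
  fun i j => FreeAlgebra.ι K (Gen.entry i j)

/-- The matrix of the free generators that become the inverse of `M_J`. -/
def freeInv (ι K : Type*) [Field K] (J : Finset ι) : Matrix J J (FreeAlgebra K (Gen ι)) :=
  fun a b => FreeAlgebra.ι K (Gen.inv J a b)

/-- Defining relations of the generic algebra: the quadratic relations of a `q`-super Manin matrix
and `M_J W_J = W_J M_J = 1`, where `W_J` is the matrix of the second kind of generators. -/
inductive GenRel {ι K : Type*} [LinearOrder ι] [Field K] (q : K) (odd : ι → Bool) :
    FreeAlgebra K (Gen ι) → FreeAlgebra K (Gen ι) → Prop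
  | sq (i j : ι) (hi : odd i = true) (hj : odd j = false) :
      GenRel q odd (freeMatrix ι K i j * freeMatrix ι K i j) 0
  | row (i k l : ι) (hi : odd i = true) :
      GenRel q odd (freeMatrix ι K i k * freeMatrix ι K i l)
        ((q ^ eps l k * (-1) ^ ((par odd k + 1) * (par odd l + 1))) •
          (freeMatrix ι K i l * freeMatrix ι K i k))
  | col (i j k : ι) (hk : odd k = false) :
      GenRel q odd (freeMatrix ι K i k * freeMatrix ι K j k)
        ((q ^ eps i j * (-1) ^ (par odd i * par odd j)) •
          (freeMatrix ι K j k * freeMatrix ι K i k))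
  | cross (i j k l : ι) :
      GenRel q odd
        (freeMatrix ι K i j * freeMatrix ι K k l
          - (q ^ (eps i k + eps l j) *
              (-1) ^ ((par odd i + par odd j) * (par odd k + par odd l))) •
            (freeMatrix ι K k l * freeMatrix ι K i j))
        ((q ^ eps i k *
            (-1) ^ (par odd i * par odd k + par odd j * par odd k + par odd i * par odd j)) •
            (freeMatrix ι K k j * freeMatrix ι K i l)
          - (q ^ eps l j *
              (-1) ^ (par odd j * par odd k + par odd j * par odd l + par odd k * par odd l)) •
            (freeMatrix ι K i l * freeMatrix ι K k j))
  | mul_inv (J : Finset ι) (a b : J) :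
      GenRel q odd ((principal (freeMatrix ι K) J * freeInv ι K J) a b)
        ((1 : Matrix J J (FreeAlgebra K (Gen ι))) a b)
  | inv_mul (J : Finset ι) (a b : J) :
      GenRel q odd ((freeInv ι K J * principal (freeMatrix ι K) J) a b)
        ((1 : Matrix J J (FreeAlgebra K (Gen ι))) a b)

/-- The generic algebra: the universal `K`-algebra with a `q`-super Manin matrix all of whose
principal submatrices are invertible. -/
abbrev GenericAlgebra {ι K : Type*} [LinearOrder ι] [Field K] (q : K) (odd : ι → Bool) : Type _ :=
  RingQuot (GenRel q odd)

/-- The generator matrix of the generic algebra. -/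
noncomputable def genericMatrix {ι K : Type*} [LinearOrder ι] [Field K] (q : K) (odd : ι → Bool) :
    Matrix ι ι (GenericAlgebra q odd) :=
  fun i j => RingQuot.mkAlgHom K (GenRel q odd) (freeMatrix ι K i j)

/-- The parity on `{1, …, m + n}`: the first `m` indices are even, the last `n` are odd. -/
def oddIdx (m n : ℕ) (i : Fin (m + n)) : Bool := decide (m ≤ (i : ℕ))

end QSuper

/-!
Eliminating the indices of `Iᶜ` one at a time turns `M` into its Schur complement `S` with respect to
`M_{Iᶜ}`. Each elimination step preserves the relations of a `q`-super Manin matrix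
(`IsTwistedManin.schur`), and for `J ⊆ I` the inverse of `S_J` is the block on `J` of the inverse of
`M_{J ∪ Iᶜ}`. The key formula is

  `Ber(M_{J ∪ Iᶜ}) = Ber(M_{Iᶜ}) * Ber(S_J)`,

with `Ber(M_{Iᶜ})` invertible (`IsCrossManin.exists_schur_berMinor`). Hence the elements
`Ber(M_{J ∪ Iᶜ}) * Ber(M_{Iᶜ})⁻¹` are the `Ber(S_J)`, all conjugated by the same unit, and they
satisfy every identity that the `Ber(S_J)` satisfy.

The key formula rests on determinants in a quantum exterior algebra. The rows of an odd Manin matrix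
`T` define linear forms obeying the same skew relations as the generators, and the product of all
these forms is the row determinant of `T` times the top monomial. This gives two facts: the
determinant of `T` is a pivot times the determinant of the Schur complement
(`rdet_insert_of_rows`), and it is inverse to the determinant, for the inverse parameter, of `T⁻¹`
(`rdet_inv_mul_rdet`). So the odd factor of a Berezinian is the inverse of a product of pivots, taken
in any chosen order of elimination. The even factor is the same for `J ∪ Iᶜ` and `Iᶜ`, and it is a
product of pivots too (`rdet_insert_of_cols`).

It remains to see that `S` inherits the identities between minor Berezinians of the generic matrix,
although it is a Manin matrix with invertible principal submatrices on `I` only. It is extended to all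
indices by a diagonal. When `Iᶜ` has odd indices interlaced with `I`, the relations force the diagonal
entries to `q`-commute with the entries of `S`. Such entries exist after enlarging `A` to operators on
`A`-valued functions on a lattice: the entries of `S` are multiplied by translations, which cancel in
Berezinians, and the diagonal entries are characters of the lattice
(`IsCrossManin.exists_algHom_generic`).
-/

namespace QSuper

open Finset

/-! ### Inversions of lists -/

section Lists

variable {ι : Type*} [LinearOrder ι]

/-- The number of inversions of a list: pairs of positions carrying a strict descent. -/
def invCount : List ι → ℕ
  | [] => 0
  | a :: l => l.countP (· < a) + invCount l

theorem invCount_map_eq_card {α : Type*} [LinearOrder α] (f : α → ι) (l : List α)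
    (hl : l.Pairwise (· < ·)) :
    invCount (l.map f) =
      ((l.toFinset ×ˢ l.toFinset).filter fun x => x.1 < x.2 ∧ f x.2 < f x.1).card := by
  induction l with
  | nil => simp [invCount]
  | cons a l ih =>
    obtain ⟨ha, hl⟩ := List.pairwise_cons.mp hl
    have hal : a ∉ l.toFinset := fun h => lt_irrefl _ (ha a (List.mem_toFinset.mp h))
    have hsplit : (((a :: l).toFinset ×ˢ (a :: l).toFinset).filter
          fun x => x.1 < x.2 ∧ f x.2 < f x.1) =
        ((l.toFinset.filter fun b => f b < f a).image (Prod.mk a))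
          ∪ ((l.toFinset ×ˢ l.toFinset).filter fun x => x.1 < x.2 ∧ f x.2 < f x.1) := by
      ext ⟨u, v⟩
      simp only [mem_filter, mem_product, List.mem_toFinset, List.mem_cons, mem_union,
        mem_image, Prod.mk.injEq]
      constructor
      · rintro ⟨⟨rfl | hu, rfl | hv⟩, h1, h2⟩
        · exact absurd h1 (lt_irrefl _)
        · exact Or.inl ⟨v, ⟨hv, h2⟩, rfl, rfl⟩
        · exact absurd (h1.trans (ha u hu)) (lt_irrefl _)
        · exact Or.inr ⟨⟨hu, hv⟩, h1, h2⟩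
      · rintro (⟨b, ⟨hb, h2⟩, rfl, rfl⟩ | ⟨⟨hu, hv⟩, h1, h2⟩)
        · exact ⟨⟨Or.inl rfl, Or.inr hb⟩, ha _ hb, h2⟩
        · exact ⟨⟨Or.inr hu, Or.inr hv⟩, h1, h2⟩
    rw [hsplit, card_union_of_disjoint,
      card_image_of_injective _ (Prod.mk_right_injective a), ← ih hl, List.map_cons, invCount]
    · congr 1
      have hn : l.Nodup := hl.imp fun h => ne_of_lt h
      rw [List.countP_map, List.countP_eq_length_filter]
      rw [← List.toFinset_card_of_nodup (hn.filter _), List.toFinset_filter]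
      simp
    · rw [disjoint_left]
      rintro ⟨u, v⟩ h1 h2
      simp only [mem_filter, mem_product, mem_image, Prod.mk.injEq] at h1 h2
      obtain ⟨b, _, rfl, _⟩ := h1
      exact hal h2.1.1

end Lists

/-! ### Skew families -/

section Skew

variable {ι K E : Type*} [LinearOrder ι] [Field K] [Ring E] [Algebra K E]

/-- A family of square-zero elements with `x i * x j = t • (x j * x i)` for `j < i`: generators of
a quantum exterior algebra. -/
structure IsSkew (t : K) (x : ι → E) : Prop where
  swap : ∀ ⦃i j⦄, j < i → x i * x j = t • (x j * x i)
  sq : ∀ i, x i * x i = 0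

namespace IsSkew

variable {t : K} {x : ι → E}

theorem mul_prod_orderedInsert (hx : IsSkew t x) (i : ι) (l : List ι)
    (hl : l.Pairwise (· ≤ ·)) :
    x i * (l.map x).prod =
      t ^ l.countP (· < i) • ((l.orderedInsert (· ≤ ·) i).map x).prod := by
  induction l with
  | nil => simp
  | cons j l ih =>
    obtain ⟨hj, hl⟩ := List.pairwise_cons.mp hl
    by_cases hij : i ≤ j
    · have h0 : (j :: l).countP (· < i) = 0 := by
        rw [List.countP_eq_zero]
        intro b hb
        have : i ≤ b := by
          rcases List.mem_cons.mp hb with rfl | hb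
          · exact hij
          · exact hij.trans (hj b hb)
        simpa using this
      simp [h0, List.orderedInsert_cons_of_le (· ≤ ·) l hij]
    · have hji : j < i := not_le.mp hij
      rw [List.orderedInsert_of_not_le (· ≤ ·) l hij, List.countP_cons_of_pos (by simpa using hji)]
      simp only [List.map_cons, List.prod_cons]
      rw [← mul_assoc, hx.swap hji, smul_mul_assoc, mul_assoc, ih hl, mul_smul_comm, smul_smul,
        pow_succ']

theorem prod_map_eq_smul_insertionSort (hx : IsSkew t x) (l : List ι) :
    (l.map x).prod = t ^ invCount l • ((l.insertionSort (· ≤ ·)).map x).prod := by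
  induction l with
  | nil => simp [invCount]
  | cons i l ih =>
    rw [List.map_cons, List.prod_cons, ih, mul_smul_comm, List.insertionSort_cons,
      hx.mul_prod_orderedInsert i _ (List.pairwise_insertionSort _ _), smul_smul, invCount,
      pow_add, mul_comm, (List.perm_insertionSort (· ≤ ·) l).countP_eq]

theorem exists_swap (hx : IsSkew t x) (ht : t ≠ 0) (i j : ι) :
    ∃ s : K, x i * x j = s • (x j * x i) := by
  rcases lt_trichotomy i j with h | rfl | h
  · exact ⟨t⁻¹, by rw [hx.swap h, smul_smul, inv_mul_cancel₀ ht, one_smul]⟩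
  · exact ⟨1, by simp⟩
  · exact ⟨t, hx.swap h⟩

theorem mul_prod_eq_zero (hx : IsSkew t x) (ht : t ≠ 0) {i : ι} {l : List ι} (hi : i ∈ l) :
    x i * (l.map x).prod = 0 := by
  induction l with
  | nil => simp at hi
  | cons j l ih =>
    rw [List.map_cons, List.prod_cons, ← mul_assoc]
    by_cases hij : i = j
    · rw [hij, hx.sq, zero_mul]
    · obtain ⟨s, hs⟩ := hx.exists_swap ht i j
      rw [hs, smul_mul_assoc, mul_assoc, ih ((List.mem_cons.mp hi).resolve_left hij), mul_zero,
        smul_zero]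

theorem prod_mul_eq_zero (hx : IsSkew t x) (ht : t ≠ 0) {i : ι} {l : List ι} (hi : i ∈ l) :
    (l.map x).prod * x i = 0 := by
  induction l using List.reverseRecOn with
  | nil => simp at hi
  | append_singleton l j ih =>
    rw [List.map_append, List.prod_append, List.map_singleton, List.prod_singleton, mul_assoc]
    by_cases hij : i = j
    · rw [hij, hx.sq, mul_zero]
    · obtain ⟨s, hs⟩ := hx.exists_swap ht j i
      have hil : i ∈ l := by
        rcases List.mem_append.mp hi with h | h
        · exact h
        · exact absurd (List.mem_singleton.mp h) hij
      rw [hs, mul_smul_comm, ← mul_assoc, ih hil, zero_mul, smul_zero]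

theorem prod_eq_zero_of_not_nodup (hx : IsSkew t x) (ht : t ≠ 0) {l : List ι} (hl : ¬ l.Nodup) :
    (l.map x).prod = 0 := by
  induction l with
  | nil => simp at hl
  | cons i l ih =>
    rw [List.map_cons, List.prod_cons]
    by_cases hi : i ∈ l
    · exact hx.mul_prod_eq_zero ht hi
    · rw [ih fun h => hl (List.nodup_cons.mpr ⟨hi, h⟩), mul_zero]

/-- Sorting a monomial costs a power of `t` that depends on the list only, so it is the same for any
two skew families with parameter `t`. -/
theorem prod_perm_sort (hx : IsSkew t x) {U : Finset ι} {l : List ι} (hl : l.Nodup)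
    (hU : l.toFinset = U) :
    (l.map x).prod = t ^ invCount l • ((U.sort).map x).prod := by
  rw [hx.prod_map_eq_smul_insertionSort]
  congr 3
  refine List.Perm.eq_of_pairwise' (r := (· ≤ ·)) (List.pairwise_insertionSort _ _)
    (Finset.pairwise_sort _ _) ?_
  refine (List.perm_insertionSort _ _).trans ?_
  refine (List.perm_of_nodup_nodup_toFinset_eq hl (Finset.sort_nodup _ _) ?_)
  rw [hU, Finset.sort_toFinset]

theorem comp_strictMono {α : Type*} [LinearOrder α] (hx : IsSkew t x) {e : α → ι}
    (he : StrictMono e) : IsSkew t (x ∘ e) :=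
  ⟨fun _ _ h => hx.swap (he h), fun i => hx.sq (e i)⟩

end IsSkew

end Skew

/-! ### Ordered products and quantum determinants -/

section OrderedProd

variable {α β : Type*} [LinearOrder α] [Fintype α] [LinearOrder β] [Fintype β]

theorem sort_univ_map_orderIso (e : α ≃o β) :
    ((univ : Finset α).sort (· ≤ ·)).map e = (univ : Finset β).sort (· ≤ ·) := by
  have := Finset.map_sort e.toEquiv.toEmbedding (univ : Finset α) (· ≤ ·) (· ≤ ·)
    (fun a _ b _ => e.le_iff_le.symm)
  simpa using this

theorem orderedProd_orderIso {A : Type*} [Monoid A] (e : α ≃o β) (f : β → A) :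
    orderedProd (fun a => f (e a)) = orderedProd f := by
  rw [orderedProd, orderedProd, ← sort_univ_map_orderIso e, List.map_map]
  rfl

theorem permLength_orderIso (e : α ≃o β) (σ : Equiv.Perm α) :
    permLength (e.toEquiv.permCongr σ) = permLength σ := by
  rw [permLength, permLength]
  symm
  refine Finset.card_equiv (e.toEquiv.prodCongr e.toEquiv) ?_
  rintro ⟨a, b⟩
  simp

theorem sum_perm_orderIso {K A : Type*} [Field K] [Ring A] [Algebra K A] (e : α ≃o β) (t : K)
    (T : β → β → A) :
    ∑ σ : Equiv.Perm α, t ^ permLength σ • orderedProd (fun a => T (e a) (e (σ a))) =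
      ∑ σ : Equiv.Perm β, t ^ permLength σ • orderedProd (fun a => T a (σ a)) := by
  refine Fintype.sum_equiv e.toEquiv.permCongr _ _ fun σ => ?_
  rw [permLength_orderIso, ← orderedProd_orderIso e]
  simp

theorem orderedProd_subtype {ι A : Type*} [LinearOrder ι] [Monoid A] (U : Finset ι) (f : ι → A) :
    orderedProd (fun a : U => f a) = ((U.sort).map f).prod := by
  have h := Finset.map_sort (Function.Embedding.subtype (· ∈ U)) (univ : Finset U) (· ≤ ·) (· ≤ ·)
    (fun a _ b _ => Iff.rfl)
  have h2 : (univ : Finset U).map (Function.Embedding.subtype (· ∈ U)) = U := by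
    ext a; simp
  rw [h2] at h
  rw [← h, List.map_map]
  rfl

theorem map_orderedProd {A B : Type*} [Monoid A] [Monoid B] (φ : A →* B) (f : α → A) :
    φ (orderedProd f) = orderedProd (fun a => φ (f a)) := by
  rw [orderedProd, map_list_prod, List.map_map]
  rfl

theorem orderedProd_mul {A : Type*} [Monoid A] (f g : α → A) (h : ∀ a b, Commute (f a) (g b)) :
    orderedProd (fun a => f a * g a) = orderedProd f * orderedProd g := by
  rw [orderedProd, orderedProd, orderedProd]
  induction (univ : Finset α).sort (· ≤ ·) with
  | nil => simp
  | cons a l ih =>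
    have hc : Commute (l.map f).prod (g a) := by
      refine Commute.list_prod_left _ _ fun y hy => ?_
      obtain ⟨b, -, rfl⟩ := List.mem_map.mp hy
      exact h b a
    simp only [List.map_cons, List.prod_cons, ih]
    rw [mul_assoc, mul_assoc, ← mul_assoc (g a), ← mul_assoc _ (g a), hc.eq]

theorem orderedProd_sum {A γ : Type*} [Ring A] [Fintype γ] (g : α → γ → A) :
    orderedProd (fun a => ∑ b, g a b) = ∑ f : α → γ, orderedProd (fun a => g a (f a)) := by
  classical
  let e : Fin (Fintype.card α) ≃o α := Fintype.orderIsoFinOfCardEq α rfl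
  have hof : ∀ f : α → A, orderedProd f = (List.ofFn fun i => f (e i)).prod := by
    intro f
    rw [← orderedProd_orderIso e, orderedProd, Fin.sort_univ, List.ofFn_eq_map]
  have key := (MultilinearMap.mkPiAlgebraFin ℤ (Fintype.card α) A).map_sum (fun i b => g (e i) b)
  simp only [MultilinearMap.mkPiAlgebraFin_apply] at key
  rw [hof, key]
  refine Fintype.sum_equiv (e.toEquiv.arrowCongr (Equiv.refl γ)) _ _ fun r => ?_
  rw [hof]
  simp [Equiv.arrowCongr]

variable {K E : Type*} [Field K] [Ring E] [Algebra K E] {t : K} {x : α → E}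

theorem IsSkew.orderedProd_perm (hx : IsSkew t x) (σ : Equiv.Perm α) :
    orderedProd (fun a => x (σ a)) = t ^ permLength σ • orderedProd x := by
  have h := hx.prod_perm_sort (U := univ) (l := ((univ : Finset α).sort (· ≤ ·)).map σ)
    ((Finset.sort_nodup _ _).map σ.injective) (by
      ext a
      simp only [List.mem_toFinset, List.mem_map, mem_sort, mem_univ, true_and, iff_true]
      exact σ.surjective a)
  rw [invCount_map_eq_card _ _ (Finset.sortedLT_sort _).pairwise, Finset.sort_toFinset,
    Finset.univ_product_univ] at h
  rw [List.map_map] at h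
  exact h

theorem IsSkew.orderedProd_eq_zero (hx : IsSkew t x) (ht : t ≠ 0) {f : α → α}
    (hf : ¬ Function.Injective f) : orderedProd (fun a => x (f a)) = 0 := by
  have h := hx.prod_eq_zero_of_not_nodup ht (l := ((univ : Finset α).sort (· ≤ ·)).map f) (by
    intro hn
    apply hf
    intro a b hab
    exact List.inj_on_of_nodup_map hn (by simp) (by simp) hab)
  rw [List.map_map] at h
  exact h

/-- Products of linear combinations of skew generators produce a quantum determinant. -/
theorem IsSkew.orderedProd_linearForms {A : Type*} [Ring A] [Algebra K A] (hx : IsSkew t x)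
    (ht : t ≠ 0) (f : A →ₐ[K] E) (hc : ∀ a i, Commute (f a) (x i)) (T : α → α → A) :
    orderedProd (fun a => ∑ b, f (T a b) * x b) =
      f (∑ σ : Equiv.Perm α, t ^ permLength σ • orderedProd (fun a => T a (σ a))) *
        orderedProd x := by
  classical
  rw [orderedProd_sum]
  have hterm : ∀ g : α → α, orderedProd (fun a => f (T a (g a)) * x (g a)) =
      f (orderedProd fun a => T a (g a)) * orderedProd (fun a => x (g a)) := by
    intro g
    rw [orderedProd_mul _ _ fun a b => hc _ _]
    congr 1
    exact (map_orderedProd (f : A →* E) _).symm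
  rw [map_sum, sum_mul]
  symm
  refine Finset.sum_bij_ne_zero (fun σ _ _ => (σ : α → α)) (fun _ _ _ => mem_univ _)
    (fun σ _ _ τ _ _ h => Equiv.coe_fn_injective h) ?_ ?_
  · intro g _ hg
    have hinj : Function.Injective g := by
      by_contra hn
      exact hg (by rw [hterm, hx.orderedProd_eq_zero ht hn, mul_zero])
    refine ⟨Equiv.ofBijective g (Finite.injective_iff_bijective.mp hinj), mem_univ _, ?_, rfl⟩
    intro h0
    apply hg
    rw [hterm]
    have := hx.orderedProd_perm (Equiv.ofBijective g (Finite.injective_iff_bijective.mp hinj))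
    simp only [Equiv.ofBijective_apply] at this h0
    rw [this, mul_smul_comm, ← smul_mul_assoc, ← map_smul]
    exact h0
  · intro σ _ _
    rw [hterm, hx.orderedProd_perm, mul_smul_comm, ← smul_mul_assoc, ← map_smul]

end OrderedProd

/-! ### A quantum exterior algebra with coefficients -/

section Model

variable {ι K A E : Type*} [LinearOrder ι] [Field K] [Ring A] [Algebra K A] [Ring E] [Algebra K E]

/-- A quantum exterior algebra with coefficients in `A`: skew generators `x i` commuting with the
image of `A`, such that no nonzero element of `A` annihilates an ordered monomial. -/
structure IsExteriorModel (t : K) (f : A →ₐ[K] E) (x : ι → E) : Prop where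
  skew : IsSkew t x
  commute : ∀ a i, Commute (f a) (x i)
  faithful : ∀ (U : Finset ι) (a b : A),
    f a * ((U.sort).map x).prod = f b * ((U.sort).map x).prod → a = b

/-- The creation operator `x i` on `A`-valued functions of finite subsets: a function `g` stands for
the sum of the `g S` times the ordered monomial of `S`. -/
def creation (t : K) (i : ι) : Module.End K (Finset ι → A) where
  toFun g S := if i ∈ S then t ^ (S.filter (· < i)).card • g (S.erase i) else 0
  map_add' g h := by
    funext S
    by_cases hi : i ∈ S <;> simp [hi]
  map_smul' c g := by
    funext S
    by_cases hi : i ∈ S <;> simp [hi, smul_comm c]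

theorem creation_apply (t : K) (i : ι) (g : Finset ι → A) (S : Finset ι) :
    creation t i g S = if i ∈ S then t ^ (S.filter (· < i)).card • g (S.erase i) else 0 := rfl

theorem creation_isSkew (t : K) : IsSkew t (creation (A := A) t : ι → _) where
  swap i j hji := by
    refine LinearMap.ext fun g => funext fun S => ?_
    simp only [Module.End.mul_apply, LinearMap.smul_apply, Pi.smul_apply, creation_apply,
      mem_erase]
    by_cases hi : i ∈ S
    · by_cases hj : j ∈ S
      · have h1 : ((S.erase i).filter (· < j)).card = (S.filter (· < j)).card := by
          congr 1
          ext b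
          simp only [mem_filter, mem_erase]
          exact ⟨fun h => ⟨h.1.2, h.2⟩, fun h => ⟨⟨(h.2.trans hji).ne, h.1⟩, h.2⟩⟩
        have h2 : (S.filter (· < i)).card = ((S.erase j).filter (· < i)).card + 1 := by
          rw [Finset.filter_erase, Finset.card_erase_add_one]
          exact mem_filter.mpr ⟨hj, hji⟩
        simp only [hi, hj, hji.ne, hji.ne', ne_eq, not_false_eq_true, and_self, if_true, h1, h2,
          smul_smul, Finset.erase_right_comm (a := i) (b := j)]
        congr 1
        ring
      · simp [hj]
    · simp [hi]
  sq i := by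
    refine LinearMap.ext fun g => funext fun S => ?_
    simp [Module.End.mul_apply, creation_apply]

/-- The ordered monomial of `U`, applied to the vacuum, has coefficient `1` at `U`. -/
theorem creation_prod_apply (t : K) (U : Finset ι) :
    (((U.sort).map (creation (A := A) t)).prod (Pi.single ∅ 1)) U = 1 := by
  induction U using Finset.induction_on_min with
  | empty => simp
  | insert a U ha ih =>
    have hau : a ∉ U := fun h => lt_irrefl _ (ha a h)
    have h0 : ((insert a U).filter (· < a)) = ∅ := by
      rw [Finset.filter_eq_empty_iff]
      intro b hb
      rcases mem_insert.mp hb with rfl | hb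
      · exact lt_irrefl _
      · exact (ha b hb).not_gt
    rw [Finset.sort_insert _ (fun b hb => (ha b hb).le) hau, List.map_cons, List.prod_cons,
      Module.End.mul_apply, creation_apply, if_pos (mem_insert_self _ _), h0, erase_insert hau, ih]
    simp

theorem creation_isExteriorModel (t : K) :
    IsExteriorModel t (Algebra.lsmul K K (Finset ι → A) : A →ₐ[K] _) (creation (A := A) t) where
  skew := creation_isSkew t
  commute a i := by
    refine LinearMap.ext fun g => funext fun S => ?_
    simp only [Module.End.mul_apply, Algebra.lsmul_coe, Pi.smul_apply, creation_apply, smul_eq_mul]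
    split_ifs <;> simp
  faithful U a b h := by
    have h1 := congrFun (LinearMap.congr_fun h (Pi.single ∅ 1)) U
    simpa only [Module.End.mul_apply, Algebra.lsmul_coe, Pi.smul_apply, creation_prod_apply,
      smul_eq_mul, mul_one] using h1

end Model

/-! ### Row determinants: pivots and inverses -/

section RowDeterminant

variable {ι K A : Type*} [LinearOrder ι] [Field K] [Ring A] [Algebra K A]

/-- The row determinant `∑_σ t^{l(σ)} ∏_{a ∈ U} T_{a,σ(a)}` of the principal submatrix `T_U`, with
the factors ordered by rows. -/
noncomputable def rdet (t : K) (U : Finset ι) (T : Matrix ι ι A) : A :=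
  ∑ σ : Equiv.Perm U, t ^ permLength σ • orderedProd fun a : U => T a (σ a)

theorem rdet_congr {t : K} {U : Finset ι} {T T' : Matrix ι ι A}
    (h : ∀ i ∈ U, ∀ j ∈ U, T i j = T' i j) : rdet t U T = rdet t U T' := by
  unfold rdet
  congr! 4 with σ _ a
  exact h _ a.2 _ (σ a).2

@[simp] theorem rdet_empty (t : K) (T : Matrix ι ι A) : rdet t ∅ T = 1 := by
  simp [rdet, orderedProd, permLength]

theorem map_rdet {B : Type*} [Ring B] [Algebra K B] (φ : A →ₐ[K] B) (t : K) (U : Finset ι)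
    (T : Matrix ι ι A) : φ (rdet t U T) = rdet t U (T.map φ) := by
  rw [rdet, rdet, map_sum]
  refine Finset.sum_congr rfl fun σ _ => ?_
  rw [map_smul]
  congr 1
  exact map_orderedProd (φ : A →* B) _

/-- The quadratic relations making the linear forms `∑_j T_{ij} x_j` skew for the parameter `-q`,
where the `x_j` are skew generators for the same parameter. -/
def IsRowManin (q : K) (U : Finset ι) (T : Matrix ι ι A) : Prop :=
  ∀ i ∈ U, ∀ k ∈ U, ∀ j ∈ U, ∀ l ∈ U,
    T i j * T k l - q ^ eps l j • (T i l * T k j) =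
      q ^ (eps i k + eps l j) • (T k l * T i j) - q ^ eps i k • (T k j * T i l)

variable {E : Type*} [Ring E] [Algebra K E] {f : A →ₐ[K] E} {x : ι → E}

theorem IsSkew.mul_eq_eps {q : K} (hq : q ≠ 0) (hx : IsSkew (-q) x) (i j : ι) :
    x i * x j = -(q ^ eps i j • (x j * x i)) := by
  rcases lt_trichotomy i j with h | rfl | h
  · simp [eps, h, h.not_gt, hx.swap h, smul_smul, hq]
  · simp [hx.sq]
  · simp [eps, h, hx.swap h]

/-- The linear form `∑_{j ∈ U} T_{ij} x_j` for `i ∈ U`, extended by zero to the other `i`. -/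
def linearForm (f : A →ₐ[K] E) (x : ι → E) (U : Finset ι) (T : Matrix ι ι A) (i : ι) : E :=
  if i ∈ U then ∑ j ∈ U, f (T i j) * x j else 0

/-- The ordered product of all linear forms on `U` is the row determinant times the top monomial. -/
theorem prod_linearForm {t : K} (ht : t ≠ 0) (hx : IsSkew t x) (hc : ∀ a i, Commute (f a) (x i))
    (U : Finset ι) (T : Matrix ι ι A) :
    ((U.sort).map (linearForm f x U T)).prod = f (rdet t U T) * ((U.sort).map x).prod := by
  rw [← orderedProd_subtype, ← orderedProd_subtype]
  have h := (hx.comp_strictMono (e := ((↑) : U → ι)) fun _ _ h => h).orderedProd_linearForms ht f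
    (fun a i => hc a i) (fun a b : U => T a b)
  refine Eq.trans ?_ h
  congr 1
  funext a
  rw [linearForm, if_pos a.2, ← Finset.sum_coe_sort U]
  rfl

theorem IsRowManin.linearForm_isSkew {q : K} (hq : q ≠ 0) (h2 : (2 : K) ≠ 0) {U : Finset ι}
    {T : Matrix ι ι A} (hT : IsRowManin q U T) (hx : IsSkew (-q) x)
    (hc : ∀ a i, Commute (f a) (x i)) : IsSkew (-q) (linearForm f x U T) := by
  -- twice a product of two forms, so that the coefficients of `x_j x_l` and `x_l x_j` can be merged
  have hprod : ∀ i ∈ U, ∀ k ∈ U, linearForm f x U T i * linearForm f x U T k =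
      ∑ j ∈ U, ∑ l ∈ U, f (T i j * T k l) * (x j * x l) := by
    intro i hi k hk
    rw [linearForm, linearForm, if_pos hi, if_pos hk, sum_mul_sum]
    refine sum_congr rfl fun j _ => sum_congr rfl fun l _ => ?_
    rw [map_mul, mul_assoc, mul_assoc, ← mul_assoc (x j), ← (hc _ _).eq, mul_assoc]
  have hdouble : ∀ i ∈ U, ∀ k ∈ U, (2 : K) • (linearForm f x U T i * linearForm f x U T k) =
      ∑ j ∈ U, ∑ l ∈ U,
        f (T i j * T k l - q ^ eps l j • (T i l * T k j)) * (x j * x l) := by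
    intro i hi k hk
    have hswap := hprod i hi k hk
    rw [sum_comm] at hswap
    rw [two_smul]
    nth_rewrite 2 [hswap]
    rw [hprod i hi k hk, ← sum_add_distrib]
    refine sum_congr rfl fun j _ => ?_
    rw [← sum_add_distrib]
    refine sum_congr rfl fun l _ => ?_
    rw [hx.mul_eq_eps hq l j, map_sub, map_smul, sub_mul, smul_mul_assoc, mul_neg, mul_smul_comm,
      sub_eq_add_neg]
  have hmain : ∀ i ∈ U, ∀ k ∈ U, linearForm f x U T i * linearForm f x U T k =
      -(q ^ eps i k • (linearForm f x U T k * linearForm f x U T i)) := by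
    intro i hi k hk
    have h : (2 : K) • (linearForm f x U T i * linearForm f x U T k) =
        (2 : K) • (-(q ^ eps i k • (linearForm f x U T k * linearForm f x U T i))) := by
      rw [smul_neg, smul_comm (2 : K), hdouble i hi k hk, hdouble k hk i hi, smul_sum,
        ← sum_neg_distrib]
      refine sum_congr rfl fun j hj => ?_
      rw [smul_sum, ← sum_neg_distrib]
      refine sum_congr rfl fun l hl => ?_
      have hneg : q ^ (eps i k + eps l j) • (T k l * T i j) - q ^ eps i k • (T k j * T i l) =
          -(q ^ eps i k • (T k j * T i l - q ^ eps l j • (T k l * T i j))) := by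
        rw [smul_sub, smul_smul, ← zpow_add₀ hq, neg_sub]
      rw [hT i hi k hk j hj l hl, hneg, map_neg, map_smul, neg_mul, smul_mul_assoc]
    exact smul_right_injective E h2 h
  refine ⟨fun i j hji => ?_, fun i => ?_⟩
  · by_cases hi : i ∈ U
    · by_cases hj : j ∈ U
      · rw [hmain i hi j hj]
        simp [eps, hji]
      · simp [linearForm, hj]
    · simp [linearForm, hi]
  · by_cases hi : i ∈ U
    · have h := hmain i hi i hi
      rw [eq_neg_iff_add_eq_zero] at h
      have h' : (2 : K) • (linearForm f x U T i * linearForm f x U T i) = 0 := by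
        rw [two_smul]
        simpa [eps] using h
      exact (smul_eq_zero.mp h').resolve_left h2
    · simp [linearForm, hi]

/-- To the left of `y a`, the factors `y i` may be changed by left multiples of `y a`. -/
theorem IsSkew.prod_mul_congr {t : K} (ht : t ≠ 0) {y φ v : ι → E} (hy : IsSkew t y) {a : ι}
    {l : List ι} (h : ∀ i ∈ l, y i = φ i + v i * y a) :
    (l.map y).prod * y a = (l.map φ).prod * y a := by
  induction l with
  | nil => simp
  | cons i l ih =>
    have ih' := ih fun j hj => h j (List.mem_cons_of_mem _ hj)
    have h0 : y a * ((l.map y).prod * y a) = 0 := by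
      have := hy.mul_prod_eq_zero ht (i := a) (l := l ++ [a]) (by simp)
      simpa [mul_assoc] using this
    rw [List.map_cons, List.prod_cons, List.map_cons, List.prod_cons, mul_assoc, h i (by simp),
      add_mul, mul_assoc (v i), h0, mul_zero, add_zero, ih', mul_assoc]

/-- To the right of `y a`, the factors `y i` may be changed by right multiples of `y a`. -/
theorem IsSkew.mul_prod_congr {t : K} (ht : t ≠ 0) {y φ v : ι → E} (hy : IsSkew t y) {a : ι}
    {l : List ι} (h : ∀ i ∈ l, y i = φ i + y a * v i) :
    y a * (l.map y).prod = y a * (l.map φ).prod := by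
  induction l with
  | nil => simp
  | cons i l ih =>
    have ih' := ih fun j hj => h j (List.mem_cons_of_mem _ hj)
    obtain ⟨s, hs⟩ := hy.exists_swap ht a i
    have h1 : y a * φ i = y a * y i := by
      rw [h i (by simp), mul_add, ← mul_assoc, hy.sq, zero_mul, add_zero]
    simp only [List.map_cons, List.prod_cons]
    rw [← mul_assoc, ← mul_assoc, h1, hs, smul_mul_assoc, smul_mul_assoc, mul_assoc, ih',
      mul_assoc]

/-- Expansion of the row determinant along a pivot `T_{aa}`, on the right. Put the form `y_a` last in
the product of all forms; the others may then be reduced modulo `y_a` to the forms of the Schur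
complement, which do not involve `x_a`. -/
theorem rdet_insert_of_rows {q : K} (hq : q ≠ 0) (h2 : (2 : K) ≠ 0) {a : ι} {V : Finset ι}
    (ha : a ∉ V) {T S : Matrix ι ι A} (hT : IsRowManin q (insert a V) T) {m : A}
    (hm : m * T a a = 1) (hS : ∀ i j, S i j = T i j - T i a * m * T a j) :
    rdet (-q) (insert a V) T = rdet (-q) V S * T a a := by
  have hX := creation_isExteriorModel (ι := ι) (A := A) (-q)
  set f : A →ₐ[K] Module.End K (Finset ι → A) := Algebra.lsmul K K (Finset ι → A)
  set x : ι → Module.End K (Finset ι → A) := creation (A := A) (-q)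
  have ht : -q ≠ 0 := neg_ne_zero.mpr hq
  set y := linearForm f x (insert a V) T with hydef
  have hy : IsSkew (-q) y := hT.linearForm_isSkew hq h2 hX.skew hX.commute
  have hya : y a = ∑ j ∈ insert a V, f (T a j) * x j := by
    rw [hydef, linearForm, if_pos (mem_insert_self _ _)]
  set l : List ι := V.sort ++ [a]
  have hln : l.Nodup := by
    simp [l, List.nodup_append, ha]
  have hlU : l.toFinset = insert a V := by
    ext b; simp [l]
  have hyl : (V.sort.map y).prod * y a = (V.sort.map (linearForm f x V S)).prod * y a := by
    refine hy.prod_mul_congr ht (v := fun i => f (T i a * m)) fun i hi => ?_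
    have hiV : i ∈ V := by simpa using hi
    rw [hya, hydef, linearForm, linearForm, if_pos hiV, if_pos (mem_insert_of_mem hiV), mul_sum,
      sum_insert ha, sum_insert ha, ← mul_assoc, ← map_mul, mul_assoc (T i a), hm, mul_one,
      add_left_comm, ← sum_add_distrib]
    congr 1
    refine sum_congr rfl fun j _ => ?_
    rw [hS, map_sub, sub_mul, ← mul_assoc, ← map_mul, sub_add_cancel]
  have hxa : (V.sort.map x).prod * y a = f (T a a) * ((V.sort.map x).prod * x a) := by
    have hcomm : ∀ b, Commute (f b) (V.sort.map x).prod := by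
      intro b
      refine Commute.list_prod_right _ _ fun z hz => ?_
      obtain ⟨i, -, rfl⟩ := List.mem_map.mp hz
      exact hX.commute b i
    rw [hya, mul_sum, sum_insert ha, sum_eq_zero, add_zero, ← mul_assoc, ← (hcomm _).eq, mul_assoc]
    intro j hj
    rw [← mul_assoc, ← (hcomm _).eq, mul_assoc, hX.skew.prod_mul_eq_zero ht (by simpa using hj),
      mul_zero]
  have e1 := hy.prod_perm_sort hln hlU
  have e2 := hX.skew.prod_perm_sort hln hlU
  simp only [l, List.map_append, List.prod_append, List.map_singleton, List.prod_singleton]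
    at e1 e2
  rw [hyl, prod_linearForm ht hX.skew hX.commute, mul_assoc, hxa, e2, hydef,
    prod_linearForm ht hX.skew hX.commute, mul_smul_comm, mul_smul_comm, ← mul_assoc,
    ← map_mul] at e1
  have e3 := smul_right_injective _ (pow_ne_zero _ ht) e1
  exact (hX.faithful _ _ _ e3).symm

/-- Expansion along a pivot on the left, with `y_a` put first. Here `S` is the transpose of the Schur
complement of the transpose of `T`; over a noncommutative ring this is not the Schur complement
of `T`. -/
theorem rdet_insert_of_cols {q : K} (hq : q ≠ 0) (h2 : (2 : K) ≠ 0) {a : ι} {V : Finset ι}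
    (ha : a ∉ V) {T S : Matrix ι ι A} (hT : IsRowManin q (insert a V) T) {m : A}
    (hm : T a a * m = 1) (hS : ∀ i j, S i j = T i j - T a j * m * T i a) :
    rdet (-q) (insert a V) T = T a a * rdet (-q) V S := by
  have hX := creation_isExteriorModel (ι := ι) (A := A) (-q)
  set f : A →ₐ[K] Module.End K (Finset ι → A) := Algebra.lsmul K K (Finset ι → A)
  set x : ι → Module.End K (Finset ι → A) := creation (A := A) (-q)
  have ht : -q ≠ 0 := neg_ne_zero.mpr hq
  set y := linearForm f x (insert a V) T with hydef
  have hy : IsSkew (-q) y := hT.linearForm_isSkew hq h2 hX.skew hX.commute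
  have hya : y a = ∑ j ∈ insert a V, f (T a j) * x j := by
    rw [hydef, linearForm, if_pos (mem_insert_self _ _)]
  set l : List ι := a :: V.sort
  have hln : l.Nodup := by
    simp [l, ha]
  have hlU : l.toFinset = insert a V := by
    ext b; simp [l]
  have hyl : y a * (V.sort.map y).prod = y a * (V.sort.map (linearForm f x V S)).prod := by
    refine hy.mul_prod_congr ht (v := fun i => f (m * T i a)) fun i hi => ?_
    have hiV : i ∈ V := by simpa using hi
    have hmove : ∀ j, f (T a j) * x j * f (m * T i a) = f (T a j * m * T i a) * x j := by
      intro j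
      rw [mul_assoc, ← (hX.commute _ _).eq, ← mul_assoc, ← map_mul, mul_assoc (T a j)]
    rw [hya, hydef, linearForm, linearForm, if_pos hiV, if_pos (mem_insert_of_mem hiV), sum_mul,
      sum_insert ha, sum_insert ha, hmove, hm, one_mul, add_left_comm, ← sum_add_distrib]
    congr 1
    refine sum_congr rfl fun j _ => ?_
    rw [hS, map_sub, sub_mul, hmove, sub_add_cancel]
  have hxa : y a * (f (rdet (-q) V S) * (V.sort.map x).prod) =
      f (T a a * rdet (-q) V S) * (x a * (V.sort.map x).prod) := by
    have hmove : ∀ j, f (T a j) * x j * (f (rdet (-q) V S) * (V.sort.map x).prod) =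
        f (T a j * rdet (-q) V S) * (x j * (V.sort.map x).prod) := by
      intro j
      rw [mul_assoc, ← mul_assoc (x j), ← (hX.commute _ _).eq, mul_assoc, ← mul_assoc, ← map_mul]
    rw [hya, sum_mul, sum_insert ha, sum_eq_zero, add_zero, hmove]
    intro j hj
    rw [hmove, hX.skew.mul_prod_eq_zero ht (by simpa using hj), mul_zero]
  have e1 := hy.prod_perm_sort hln hlU
  have e2 := hX.skew.prod_perm_sort hln hlU
  simp only [l, List.map_cons, List.prod_cons] at e1 e2
  rw [hyl, prod_linearForm ht hX.skew hX.commute, hxa, e2, hydef,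
    prod_linearForm ht hX.skew hX.commute, mul_smul_comm] at e1
  have e3 := smul_right_injective _ (pow_ne_zero _ ht) e1
  exact (hX.faithful _ _ _ e3).symm

/-- Right multiplications by a skew family form a skew family for the inverse parameter. -/
theorem IsSkew.mulRight {t : K} (ht : t ≠ 0) {y : ι → E} (hy : IsSkew t y) :
    IsSkew t⁻¹ (fun i => LinearMap.mulRight K (y i)) where
  swap i j hji := by
    refine LinearMap.ext fun z => ?_
    simp only [Module.End.mul_apply, LinearMap.mulRight_apply, LinearMap.smul_apply, mul_assoc]
    rw [hy.swap hji, mul_smul_comm, smul_smul, inv_mul_cancel₀ ht, one_smul]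
  sq i := by
    refine LinearMap.ext fun z => ?_
    simp [Module.End.mul_apply, mul_assoc, hy.sq]

theorem list_prod_mulRight {J : Type*} (y : J → E) (l : List J) :
    (l.map fun i => LinearMap.mulRight K (y i)).prod (1 : E) = (l.reverse.map y).prod := by
  induction l with
  | nil => simp
  | cons i l ih => simp [Module.End.mul_apply, ih]

/-- If `Q T = 1`, the determinants of `Q` and `T` for inverse parameters multiply to `1`. No relations
are required of `Q`: since `x_i = ∑_j Q_{ij} y_j`, the reversed top monomial of the `x_i` is the
determinant of `Q` times that of the `y_i`, computed with right multiplications by the `y_j`, which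
are skew for the inverse parameter and commute with the left multiplications by entries of `Q`. -/
theorem rdet_inv_mul_rdet {q : K} (hq : q ≠ 0) (h2 : (2 : K) ≠ 0) {U : Finset ι}
    {T Q : Matrix ι ι A} (hT : IsRowManin q U T)
    (hQ : ∀ i ∈ U, ∀ j ∈ U, ∑ l ∈ U, Q i l * T l j = if i = j then 1 else 0) :
    rdet (-q)⁻¹ U Q * rdet (-q) U T = 1 := by
  have hX := creation_isExteriorModel (ι := ι) (A := A) (-q)
  set f : A →ₐ[K] Module.End K (Finset ι → A) := Algebra.lsmul K K (Finset ι → A)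
  set x : ι → Module.End K (Finset ι → A) := creation (A := A) (-q)
  have ht : -q ≠ 0 := neg_ne_zero.mpr hq
  set y := linearForm f x U T with hydef
  have hy : IsSkew (-q) y := hT.linearForm_isSkew hq h2 hX.skew hX.commute
  set g : A →ₐ[K] Module.End K (Module.End K (Finset ι → A)) := (Algebra.lsmul K K _).comp f
  have hcg : ∀ a i, Commute (g a) (LinearMap.mulRight K (y i)) := fun a i =>
    LinearMap.ext fun z => by simp [g, Module.End.mul_apply, mul_assoc]
  have hxy : ∀ i ∈ U, ∑ j ∈ U, f (Q i j) * y j = x i := by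
    intro i hi
    have : ∀ j ∈ U, f (Q i j) * y j = ∑ l ∈ U, f (Q i j * T j l) * x l := by
      intro j hj
      rw [hydef, linearForm, if_pos hj, mul_sum]
      refine sum_congr rfl fun l _ => ?_
      rw [map_mul, mul_assoc]
    rw [sum_congr rfl this, sum_comm]
    have h3 : ∀ l ∈ U, ∑ j ∈ U, f (Q i j * T j l) * x l = if i = l then x l else 0 := by
      intro l hl
      rw [← sum_mul, ← map_sum, hQ i hi l hl]
      split_ifs <;> simp
    rw [sum_congr rfl h3]
    simp [hi]
  -- the operators `z ↦ ∑ Q_{ij} z y_j` append the generator `x_i` to a monomial `z`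
  have happend : ∀ l : List ι, (∀ i ∈ l, i ∈ U) →
      (l.map (linearForm g (fun i => LinearMap.mulRight K (y i)) U Q)).prod 1 =
        (l.reverse.map x).prod := by
    intro l
    induction l with
    | nil => simp
    | cons i l ih =>
      intro hl
      have hcomm : ∀ b, Commute (f b) (l.reverse.map x).prod := by
        intro b
        refine Commute.list_prod_right _ _ fun z hz => ?_
        obtain ⟨j, -, rfl⟩ := List.mem_map.mp hz
        exact hX.commute b j
      have hiU := hl i (by simp)
      rw [List.map_cons, List.prod_cons, Module.End.mul_apply,
        ih fun j hj => hl j (List.mem_cons_of_mem _ hj), linearForm, if_pos hiU,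
        LinearMap.sum_apply, List.reverse_cons, List.map_append, List.prod_append,
        List.map_singleton, List.prod_singleton, ← hxy i hiU, mul_sum]
      refine sum_congr rfl fun j _ => ?_
      simp only [g, Module.End.mul_apply, LinearMap.mulRight_apply, AlgHom.comp_apply,
        Algebra.lsmul_coe, smul_eq_mul]
      rw [← mul_assoc, (hcomm _).eq, mul_assoc]
  have e0 := LinearMap.congr_fun (prod_linearForm (inv_ne_zero ht) (hy.mulRight ht) hcg U Q) 1
  rw [happend _ (by simp), Module.End.mul_apply, list_prod_mulRight] at e0
  have hrn : (U.sort).reverse.Nodup := by simp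
  have hrU : (U.sort).reverse.toFinset = U := by simp
  rw [hX.skew.prod_perm_sort hrn hrU, hy.prod_perm_sort hrn hrU, hydef,
    prod_linearForm ht hX.skew hX.commute] at e0
  simp only [g, AlgHom.comp_apply, Algebra.lsmul_coe, smul_eq_mul, mul_smul_comm] at e0
  have e1 := smul_right_injective _ (pow_ne_zero _ ht) e0
  refine (hX.faithful U _ _ ?_).symm
  rw [map_one, one_mul, map_mul, mul_assoc]
  exact e1

end RowDeterminant

/-! ### Schur complements of Manin matrices -/

section SchurStep

variable {ι K A : Type*} [Field K] [Ring A] [Algebra K A]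

/-- The relations of a Manin matrix in multiparameter form: the symbols `∑_j M_{ij} x_j` obey
`y_i y_k = c_{ik} y_k y_i` whenever the `x_j` do, where moving `x_j` past a row label `k` costs the
factor `τ_{jk}`. -/
def IsTwistedManin (c τ : ι → ι → K) (M : Matrix ι ι A) : Prop :=
  ∀ i k j l, τ j k • (M i j * M k l) + (c l j * τ l k) • (M i l * M k j) =
    (c i k * τ j i) • (M k j * M i l) + (c i k * c l j * τ l i) • (M k l * M i j)

/-- Elimination of the index `a` by the pivot `M_{aa}`, whose inverse is `m`. -/
def schur (M : Matrix ι ι A) (a : ι) (m : A) : Matrix ι ι A :=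
  fun i j => M i j - M i a * m * M a j

/-- Eliminating one index preserves the relations. With `y_i = ∑_j M_{ij} x_j` and `φ_i` the
corresponding form of the Schur complement, `φ_i φ_k - c_{ik} φ_k φ_i` is a multiple `ω y_a` of
`y_a` without any term in `x_a`; invertibility of `M_{aa}` then forces `ω y_a = 0`. -/
theorem IsTwistedManin.schur {c τ : ι → ι → K} {M : Matrix ι ι A} (hM : IsTwistedManin c τ M)
    (h2 : (2 : K) ≠ 0) {a : ι} (ha : c a a = 1 ∨ c a a = -1 ∧ τ a a = -1) {m : A}
    (hm : m * M a a = 1) (hm' : M a a * m = 1) : IsTwistedManin c τ (schur M a m) := by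
  intro i k j l
  -- the coefficients of `ω`
  let w : ι → A := fun j =>
    -(τ j k • (QSuper.schur M a m i j * (M k a * m))) - (c a k * τ j a) • (M i a * m * M k j)
      + (c i k * τ j i) • (QSuper.schur M a m k j * (M i a * m))
      + (c i k * c a i * τ j a) • (M k a * m * M i j)
  have hdefect : ∀ j l,
      τ j k • (QSuper.schur M a m i j * QSuper.schur M a m k l)
        + (c l j * τ l k) • (QSuper.schur M a m i l * QSuper.schur M a m k j)
        - ((c i k * τ j i) • (QSuper.schur M a m k j * QSuper.schur M a m i l)
          + (c i k * c l j * τ l i) • (QSuper.schur M a m k l * QSuper.schur M a m i j)) =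
      w j * M a l + c l j • (w l * M a j) := by
    intro j l
    have r1 := hM i k j l
    have r2 := congrArg (M i a * m * ·) (hM a k j l)
    have r3 := congrArg (M k a * m * ·) (hM a i j l)
    simp only [w, QSuper.schur, mul_add, mul_sub, sub_mul, add_mul, neg_mul, smul_mul_assoc,
      mul_smul_comm, mul_assoc] at r1 r2 r3 ⊢
    linear_combination (norm := module) r1 - r2 + c i k • r3
  have hzero : ∀ i, QSuper.schur M a m i a = 0 := by
    intro i
    rw [QSuper.schur, mul_assoc, hm, mul_one, sub_self]
  have hw : ∀ j, w j = -(c a j • (w a * (M a j * m))) := by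
    intro j
    have h := congrArg (· * m) (hdefect j a)
    simp only [hzero, mul_zero, zero_mul, smul_zero, add_zero, sub_self, add_mul, mul_assoc, hm',
      mul_one, smul_mul_assoc] at h
    exact eq_neg_of_add_eq_zero_left h.symm
  have hgoal : w j * M a l + c l j • (w l * M a j) = 0 := by
    rcases ha with ha | ⟨ha, hτ⟩
    · have hwa : w a = 0 := by
        have h := hw a
        rw [hm', mul_one, ha, one_smul, eq_neg_iff_add_eq_zero, ← two_smul K] at h
        exact (smul_eq_zero.mp h).resolve_left h2
      rw [hw j, hw l, hwa]
      simp
    · have hrow : ∀ j l, τ j a • (M a j * M a l) + (c l j * τ l a) • (M a l * M a j) = 0 := by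
        intro j l
        have h := hM a a j l
        rw [ha] at h
        have h' : (2 : K) • (τ j a • (M a j * M a l) + (c l j * τ l a) • (M a l * M a j)) = 0 := by
          linear_combination (norm := module) h
        exact (smul_eq_zero.mp h').resolve_left h2
      have hmove : ∀ j, c a j • (M a j * m) = τ j a • (m * M a j) := by
        intro j
        have h := congrArg (m * · * m) (hrow j a)
        simp only [hτ, mul_add, add_mul, mul_smul_comm, smul_mul_assoc, mul_zero, zero_mul] at h
        rw [← mul_assoc m (M a a), hm, one_mul, ← mul_assoc m, mul_assoc (m * M a j), hm',
          mul_one] at h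
        linear_combination (norm := module) -h
      have h1 : w j = -(w a * (τ j a • (m * M a j))) := by rw [hw j, ← hmove, mul_smul_comm]
      have h2' : w l = -(w a * (τ l a • (m * M a l))) := by rw [hw l, ← hmove, mul_smul_comm]
      have h3 := congrArg (w a * m * ·) (hrow j l)
      rw [h1, h2']
      simp only [mul_add, neg_mul, smul_mul_assoc, mul_smul_comm, mul_assoc, mul_zero] at h3 ⊢
      linear_combination (norm := module) -h3
  exact sub_eq_zero.mp ((hdefect j l).trans hgoal)

/-- `N` restricts to a two-sided inverse of the principal submatrix `M_L`. Entries outside `L × L`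
play no role. -/
def InvOn [DecidableEq ι] (L : Finset ι) (M N : Matrix ι ι A) : Prop :=
  (∀ i ∈ L, ∀ j ∈ L, ∑ l ∈ L, M i l * N l j = if i = j then 1 else 0) ∧
    ∀ i ∈ L, ∀ j ∈ L, ∑ l ∈ L, N i l * M l j = if i = j then 1 else 0

variable [DecidableEq ι]

theorem InvOn.schur {L : Finset ι} {M N : Matrix ι ι A} {a : ι} {m : A} (haL : a ∉ L)
    (h : InvOn (insert a L) M N) (hm : m * M a a = 1) (hm' : M a a * m = 1) :
    InvOn L (schur M a m) N := by
  constructor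
  · intro i hi j hj
    have e1 := h.1 i (mem_insert_of_mem hi) j (mem_insert_of_mem hj)
    have e2 := h.1 a (mem_insert_self _ _) j (mem_insert_of_mem hj)
    have haj : a ≠ j := fun h => haL (h ▸ hj)
    rw [sum_insert haL] at e1 e2
    rw [if_neg haj] at e2
    simp only [QSuper.schur, sub_mul, sum_sub_distrib, mul_assoc]
    rw [← mul_sum, ← mul_sum, eq_neg_of_add_eq_zero_right e2, mul_neg, ← mul_assoc m, hm, one_mul,
      mul_neg, sub_neg_eq_add, add_comm, e1]
  · intro i hi j hj
    have e1 := h.2 i (mem_insert_of_mem hi) j (mem_insert_of_mem hj)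
    have e2 := h.2 i (mem_insert_of_mem hi) a (mem_insert_self _ _)
    have hai : i ≠ a := fun h => haL (h ▸ hi)
    rw [sum_insert haL] at e1 e2
    rw [if_neg hai] at e2
    simp only [QSuper.schur, mul_sub, sum_sub_distrib, ← mul_assoc]
    rw [← sum_mul, ← sum_mul, eq_neg_of_add_eq_zero_right e2, neg_mul, mul_assoc _ (M a a), hm',
      mul_one, neg_mul, sub_neg_eq_add, add_comm, e1]

theorem InvOn.singleton {M N : Matrix ι ι A} {a : ι} (h : InvOn {a} M N) :
    M a a * N a a = 1 ∧ N a a * M a a = 1 := by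
  have h1 := h.1 a (mem_singleton_self a) a (mem_singleton_self a)
  have h2 := h.2 a (mem_singleton_self a) a (mem_singleton_self a)
  simpa using And.intro h1 h2

end SchurStep

/-! ### The super relations -/

section Super

variable {ι K A : Type*} [LinearOrder ι] [Field K] [Ring A] [Algebra K A] {q : K} {odd : ι → Bool}

theorem eps_swap (i j : ι) : eps j i = -eps i j := by
  rcases lt_trichotomy i j with h | rfl | h
  · simp [eps, h, h.not_gt]
  · simp [eps]
  · simp [eps, h, h.not_gt]

/-- The cross relations alone. They imply the others when `2` is invertible. -/
def IsCrossManin (q : K) (odd : ι → Bool) (M : Matrix ι ι A) : Prop :=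
  ∀ i j k l,
    M i j * M k l
        - (q ^ (eps i k + eps l j) *
            (-1) ^ ((par odd i + par odd j) * (par odd k + par odd l))) • (M k l * M i j) =
      (q ^ eps i k *
          (-1) ^ (par odd i * par odd k + par odd j * par odd k + par odd i * par odd j)) •
          (M k j * M i l)
        - (q ^ eps l j *
            (-1) ^ (par odd j * par odd k + par odd j * par odd l + par odd k * par odd l)) •
          (M i l * M k j)

theorem par_eq_one {J : Type*} {odd : J → Bool} {i : J} (h : odd i = true) :
    par odd i = 1 := by simp [par, h]

theorem par_eq_zero {J : Type*} {odd : J → Bool} {i : J} (h : odd i = false) :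
    par odd i = 0 := by simp [par, h]

theorem par_eq_zero_or_one {J : Type*} {odd : J → Bool} (i : J) :
    par odd i = 0 ∨ par odd i = 1 := by
  cases h : odd i <;> simp [par, h]

theorem IsCrossManin.isQSuperManin (h2 : (2 : K) ≠ 0) {M : Matrix ι ι A}
    (hM : IsCrossManin q odd M) : IsQSuperManin q odd M where
  sq_eq_zero i j hi hj := by
    have h := hM i j i j
    rw [par_eq_one hi, par_eq_zero hj] at h
    simp only [eps, lt_irrefl, if_false, add_zero, zpow_zero] at h
    have h' : (2 * 2 : K) • (M i j * M i j) = 0 := by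
      linear_combination (norm := module) h
    exact (smul_eq_zero.mp h').resolve_left (mul_ne_zero h2 h2)
  row i k l hi := by
    have h := hM i k i l
    rw [par_eq_one hi] at h
    refine smul_right_injective A h2 ?_
    have hii : eps i i = 0 := by simp [eps]
    rw [hii, zpow_zero] at h
    rcases par_eq_zero_or_one (odd := odd) k with hk | hk <;>
    rcases par_eq_zero_or_one (odd := odd) l with hl | hl <;>
    · simp only [hk, hl, zero_add] at h ⊢
      linear_combination (norm := module) h
  col i j k hk := by
    have h := hM i k j k
    rw [par_eq_zero hk] at h
    refine smul_right_injective A h2 ?_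
    have hkk : eps k k = 0 := by simp [eps]
    rw [hkk, zpow_zero] at h
    rcases par_eq_zero_or_one (odd := odd) i with hi | hi <;>
    rcases par_eq_zero_or_one (odd := odd) j with hj | hj <;>
    · simp only [hi, hj, add_zero] at h ⊢
      linear_combination (norm := module) h
  cross := hM

theorem isCrossManin_iff_isTwistedManin (hq : q ≠ 0) {M : Matrix ι ι A} :
    IsCrossManin q odd M ↔ IsTwistedManin
      (fun i j => q ^ eps i j * (-1) ^ (par odd i * par odd j))
      (fun i j => (-1) ^ (par odd i * par odd j)) M := by
  constructor
  · intro h i k j l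
    have h := congrArg (((-1 : K) ^ (par odd j * par odd k)) • ·) (h i j k l)
    simp only [zpow_add₀ hq] at h
    rcases par_eq_zero_or_one (odd := odd) i with hi | hi <;>
    rcases par_eq_zero_or_one (odd := odd) j with hj | hj <;>
    rcases par_eq_zero_or_one (odd := odd) k with hk | hk <;>
    rcases par_eq_zero_or_one (odd := odd) l with hl | hl <;>
    · simp only [hi, hj, hk, hl] at h ⊢
      linear_combination (norm := module) h
  · intro h i j k l
    have h := congrArg (((-1 : K) ^ (par odd j * par odd k)) • ·) (h i k j l)
    simp only [zpow_add₀ hq]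
    rcases par_eq_zero_or_one (odd := odd) i with hi | hi <;>
    rcases par_eq_zero_or_one (odd := odd) j with hj | hj <;>
    rcases par_eq_zero_or_one (odd := odd) k with hk | hk <;>
    rcases par_eq_zero_or_one (odd := odd) l with hl | hl <;>
    · simp only [hi, hj, hk, hl] at h ⊢
      linear_combination (norm := module) h

theorem IsCrossManin.schur (hq : q ≠ 0) (h2 : (2 : K) ≠ 0) {M : Matrix ι ι A}
    (hM : IsCrossManin q odd M) {a : ι} {m : A} (hm : m * M a a = 1) (hm' : M a a * m = 1) :
    IsCrossManin q odd (schur M a m) := by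
  rw [isCrossManin_iff_isTwistedManin hq] at hM ⊢
  refine hM.schur h2 ?_ hm hm'
  rcases par_eq_zero_or_one (odd := odd) a with ha | ha <;> simp [ha, eps]

theorem IsCrossManin.isRowManin {M : Matrix ι ι A} (hM : IsCrossManin q odd M) {U : Finset ι}
    (hU : ∀ i ∈ U, odd i = true) : IsRowManin q U M := by
  intro i hi k hk j hj l hl
  have h := hM i j k l
  rw [par_eq_one (hU i hi), par_eq_one (hU j hj), par_eq_one (hU k hk), par_eq_one (hU l hl)] at h
  linear_combination (norm := module) h

theorem IsCrossManin.isRowManin_transpose {M : Matrix ι ι A}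
    (hM : IsCrossManin q odd M) {U : Finset ι} (hU : ∀ i ∈ U, odd i = false) :
    IsRowManin q⁻¹ U M.transpose := by
  intro i hi k hk j hj l hl
  have h := hM j i l k
  rw [par_eq_zero (hU i hi), par_eq_zero (hU j hj), par_eq_zero (hU k hk),
    par_eq_zero (hU l hl)] at h
  simp only [Matrix.transpose_apply, inv_zpow', neg_add, ← eps_swap]
  rw [add_comm (eps k i)]
  linear_combination (norm := module) h

end Super

/-! ### Iterated elimination -/

section Elimination

variable {ι K A : Type*} [LinearOrder ι] [Field K] [Ring A] [Algebra K A] {q : K} {odd : ι → Bool}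

/-- Elimination of a set `U` of indices. The result `S` is pinned down by its inverses: the block on
`L` of the inverse of `M_{L ∪ U}` is inverse to `S_L`. -/
theorem IsCrossManin.exists_schur (hq : q ≠ 0) (h2 : (2 : K) ≠ 0) {M : Matrix ι ι A}
    (hM : IsCrossManin q odd M) (hinv : ∀ L : Finset ι, ∃ N, InvOn L M N) (U : Finset ι) :
    ∃ S : Matrix ι ι A, IsCrossManin q odd S ∧
      ∀ L N, Disjoint L U → InvOn (L ∪ U) M N → InvOn L S N := by
  induction U using Finset.induction_on with
  | empty => exact ⟨M, hM, fun L N _ h => by simpa using h⟩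
  | insert a U ha ih =>
    obtain ⟨S, hS, hSinv⟩ := ih
    obtain ⟨N, hN⟩ := hinv ({a} ∪ U)
    obtain ⟨h1, h1'⟩ := (hSinv {a} N (disjoint_singleton_left.mpr ha) hN).singleton
    refine ⟨QSuper.schur S a (N a a), hS.schur hq h2 h1' h1, fun L N' hL hN' => ?_⟩
    obtain ⟨haL, hLU⟩ := disjoint_insert_right.mp hL
    refine InvOn.schur haL (hSinv (insert a L) N' (disjoint_insert_left.mpr ⟨ha, hLU⟩) ?_) h1' h1
    rwa [insert_union, ← union_insert]

/-- Elimination of a set `U` of odd indices, with the factorization of row determinants. The factor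
`p` is the product of the pivots and does not depend on `L`. -/
theorem IsCrossManin.exists_schur_rdet (hq : q ≠ 0) (h2 : (2 : K) ≠ 0) {T : Matrix ι ι A}
    (hT : IsCrossManin q odd T) {O : Finset ι} (hO : ∀ i ∈ O, odd i = true)
    (hinv : ∀ L ⊆ O, ∃ N, InvOn L T N) (U : Finset ι) (hU : U ⊆ O) :
    ∃ (S : Matrix ι ι A) (p : A), IsCrossManin q odd S ∧ IsUnit p ∧
      ∀ L ⊆ O, Disjoint L U → (∀ N, InvOn (L ∪ U) T N → InvOn L S N) ∧
        rdet (-q) (L ∪ U) T = rdet (-q) L S * p := by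
  induction U using Finset.induction_on with
  | empty => exact ⟨T, 1, hT, isUnit_one, fun L _ _ => by simp⟩
  | insert a U ha ih =>
    obtain ⟨haO, hUO⟩ := insert_subset_iff.mp hU
    obtain ⟨S, p, hS, hp, hSL⟩ := ih hUO
    obtain ⟨N, hN⟩ := hinv ({a} ∪ U) (union_subset (singleton_subset_iff.mpr haO) hUO)
    obtain ⟨h1, h1'⟩ := ((hSL {a} (singleton_subset_iff.mpr haO)
      (disjoint_singleton_left.mpr ha)).1 N hN).singleton
    refine ⟨QSuper.schur S a (N a a), S a a * p, hS.schur hq h2 h1' h1,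
      IsUnit.mul ⟨⟨_, _, h1, h1'⟩, rfl⟩ hp, fun L hLO hL => ?_⟩
    obtain ⟨haL, hLU⟩ := disjoint_insert_right.mp hL
    have hsub : insert a L ⊆ O := insert_subset haO hLO
    obtain ⟨hi1, hi2⟩ := hSL (insert a L) hsub (disjoint_insert_left.mpr ⟨ha, hLU⟩)
    rw [union_insert, ← insert_union]
    refine ⟨fun N' hN' => InvOn.schur haL (hi1 N' hN') h1' h1, ?_⟩
    rw [hi2, rdet_insert_of_rows hq h2 haL (S := QSuper.schur S a (N a a))
      (hS.isRowManin fun i hi => hO i (hsub hi)) h1' (fun i j => rfl), mul_assoc]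

/-- The column determinant of an even block is a product of pivots. -/
theorem IsCrossManin.isUnit_rdet_transpose (hq : q ≠ 0) (h2 : (2 : K) ≠ 0) (U : Finset ι)
    (hU : ∀ i ∈ U, odd i = false) {M : Matrix ι ι A} (hM : IsCrossManin q odd M)
    (hinv : ∀ L ⊆ U, ∃ N, InvOn L M N) : IsUnit (rdet (-q)⁻¹ U M.transpose) := by
  induction U using Finset.induction_on generalizing M with
  | empty => simp
  | insert a U ha ih =>
    obtain ⟨N, hN⟩ := hinv {a} (by simp)
    obtain ⟨h1, h1'⟩ := hN.singleton
    have hrow := hM.isRowManin_transpose hU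
    rw [inv_neg, rdet_insert_of_cols (inv_ne_zero hq) h2 ha hrow
      (S := (QSuper.schur M a (N a a)).transpose) h1 (fun i j => rfl), ← inv_neg]
    refine IsUnit.mul ⟨⟨_, _, h1, h1'⟩, rfl⟩
      (ih (fun i hi => hU i (mem_insert_of_mem hi)) (hM.schur hq h2 h1' h1) fun L hL => ?_)
    obtain ⟨N', hN'⟩ := hinv (insert a L) (insert_subset_insert a hL)
    exact ⟨N', InvOn.schur (fun h => ha (hL h)) hN' h1' h1⟩

end Elimination

/-! ### Berezinians and the generic algebra -/

section Berezinian

variable {ι K A : Type*} [LinearOrder ι] [Field K] [Ring A] [Algebra K A] {q : K} {odd : ι → Bool}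

theorem InvOn.principal_mul {L : Finset ι} {M N : Matrix ι ι A} (h : InvOn L M N) :
    principal M L * principal N L = 1 ∧ principal N L * principal M L = 1 := by
  constructor <;> ext a b
  · rw [Matrix.mul_apply, Matrix.one_apply]
    refine ((Finset.sum_coe_sort L fun l => M a l * N l b).trans (h.1 a a.2 b b.2)).trans ?_
    exact if_congr Subtype.ext_iff.symm rfl rfl
  · rw [Matrix.mul_apply, Matrix.one_apply]
    refine ((Finset.sum_coe_sort L fun l => N a l * M l b).trans (h.2 a a.2 b b.2)).trans ?_
    exact if_congr Subtype.ext_iff.symm rfl rfl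

/-- A matrix indexed by `L`, extended by zero. -/
def extendZero (L : Finset ι) (W : Matrix L L A) : Matrix ι ι A :=
  fun i j => if h : i ∈ L ∧ j ∈ L then W ⟨i, h.1⟩ ⟨j, h.2⟩ else 0

theorem principal_extendZero (L : Finset ι) (W : Matrix L L A) :
    principal (extendZero L W) L = W := by
  ext a b
  simp [principal, extendZero]

theorem invOn_of_principal_mul {L : Finset ι} {M N : Matrix ι ι A}
    (h : principal M L * principal N L = 1) (h' : principal N L * principal M L = 1) :
    InvOn L M N := by
  constructor
  · intro i hi j hj
    have e := congrFun (congrFun h ⟨i, hi⟩) ⟨j, hj⟩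
    rw [Matrix.mul_apply, Matrix.one_apply] at e
    refine ((Finset.sum_coe_sort L fun l => M i l * N l j).symm.trans e).trans ?_
    simp
  · intro i hi j hj
    have e := congrFun (congrFun h' ⟨i, hi⟩) ⟨j, hj⟩
    rw [Matrix.mul_apply, Matrix.one_apply] at e
    refine ((Finset.sum_coe_sort L fun l => N i l * M l j).symm.trans e).trans ?_
    simp

theorem exists_invOn_of_isUnit {L : Finset ι} {M : Matrix ι ι A} (h : IsUnit (principal M L)) :
    ∃ N, InvOn L M N := by
  obtain ⟨u, hu⟩ := h
  refine ⟨extendZero L ((u⁻¹ : (Matrix L L A)ˣ) : Matrix L L A), invOn_of_principal_mul ?_ ?_⟩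
  · rw [principal_extendZero, ← hu, Units.mul_inv]
  · rw [principal_extendZero, ← hu, Units.inv_mul]

theorem InvOn.map {B : Type*} [Ring B] [Algebra K B] (φ : A →ₐ[K] B) {L : Finset ι}
    {M N : Matrix ι ι A} (h : InvOn L M N) : InvOn L (M.map φ) (N.map φ) := by
  constructor
  · intro i hi j hj
    have e := congrArg φ (h.1 i hi j hj)
    rw [map_sum] at e
    simpa [apply_ite φ] using e
  · intro i hi j hj
    have e := congrArg φ (h.2 i hi j hj)
    rw [map_sum] at e
    simpa [apply_ite φ] using e

/-- The indices of parity `b` in `L`, as a subtype of `L` and as a finset. -/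
def parityIso (odd : ι → Bool) (L : Finset ι) (b : Bool) :
    {i : L // odd i.1 = b} ≃o (L.filter fun i => odd i = b : Finset ι) where
  toFun i := ⟨i.1.1, mem_filter.mpr ⟨i.1.2, i.2⟩⟩
  invFun i := ⟨⟨i.1, (mem_filter.mp i.2).1⟩, (mem_filter.mp i.2).2⟩
  left_inv _ := rfl
  right_inv _ := rfl
  map_rel_iff' := Iff.rfl

theorem sum_perm_parity (q : K) (odd : ι → Bool) (L : Finset ι) (b : Bool) (T : Matrix ι ι A) :
    ∑ σ : Equiv.Perm {i : L // odd i.1 = b}, (-q) ^ (-(permLength σ : ℤ)) •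
        orderedProd (fun a : {i : L // odd i.1 = b} => T a.1 (σ a).1) =
      rdet (-q)⁻¹ (L.filter fun i => odd i = b) T := by
  refine Eq.trans (Finset.sum_congr rfl fun σ _ => ?_)
    (sum_perm_orderIso (parityIso odd L b) (-q)⁻¹ fun a b => T a b)
  rw [zpow_neg, zpow_natCast, inv_pow]
  rfl

theorem ber_eq_of_mul_eq_one [Fintype ι] {M W : Matrix ι ι A} (h : M * W = 1) (h' : W * M = 1) :
    ber q odd M =
      (∑ σ : Equiv.Perm {i : ι // odd i = false}, (-q) ^ (-(permLength σ : ℤ)) •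
        orderedProd fun a : {i : ι // odd i = false} => M (σ a).1 a.1) *
      (∑ ρ : Equiv.Perm {i : ι // odd i = true}, (-q) ^ (-(permLength ρ : ℤ)) •
        orderedProd fun a : {i : ι // odd i = true} => W a.1 (ρ a).1) := by
  have hinv : Ring.inverse M = W := Ring.inverse_unit ⟨M, W, h, h'⟩
  unfold ber
  simp only [hinv]

/-- The minor Berezinian in terms of row determinants; the first factor is a column determinant, that
is, a row determinant of the transpose. -/
theorem InvOn.berMinor_eq {L : Finset ι} {M N : Matrix ι ι A} (h : InvOn L M N) :
    berMinor q odd M L = rdet (-q)⁻¹ (L.filter fun i => odd i = false) M.transpose *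
      rdet (-q)⁻¹ (L.filter fun i => odd i = true) N := by
  rw [← sum_perm_parity, ← sum_perm_parity]
  refine ber_eq_of_mul_eq_one (W := principal N L) ?_ ?_
  · convert h.principal_mul.1
  · convert h.principal_mul.2

theorem InvOn.berMinor_of_odd {L : Finset ι} {M N : Matrix ι ι A} (h : InvOn L M N)
    (hL : ∀ i ∈ L, odd i = true) : berMinor q odd M L = rdet (-q)⁻¹ L N := by
  rw [h.berMinor_eq, Finset.filter_true_of_mem hL,
    Finset.filter_false_of_mem (fun i hi => by simp [hL i hi]), rdet_empty, one_mul]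

theorem InvOn.map_berMinor {B : Type*} [Ring B] [Algebra K B] (φ : A →ₐ[K] B) {L : Finset ι}
    {M N : Matrix ι ι A} (h : InvOn L M N) :
    φ (berMinor q odd M L) = berMinor q odd (M.map φ) L := by
  rw [h.berMinor_eq, (h.map φ).berMinor_eq, map_mul, map_rdet, map_rdet]
  rfl

theorem exists_invOn_genericMatrix (q : K) (odd : ι → Bool) (L : Finset ι) :
    ∃ N, InvOn L (genericMatrix q odd) N := by
  have hentry : ∀ x y : Matrix L L (FreeAlgebra K (Gen ι)),
      (fun a b => RingQuot.mkAlgHom K (GenRel q odd) ((x * y) a b)) =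
        x.map (RingQuot.mkAlgHom K (GenRel q odd)) * y.map (RingQuot.mkAlgHom K (GenRel q odd)) := by
    intro x y
    ext a b
    simp [Matrix.mul_apply]
  have hone : (fun a b => RingQuot.mkAlgHom K (GenRel q odd)
      ((1 : Matrix L L (FreeAlgebra K (Gen ι))) a b)) = (1 : Matrix L L (GenericAlgebra q odd)) := by
    ext a b
    rw [Matrix.one_apply, Matrix.one_apply]
    split_ifs <;> simp
  refine ⟨extendZero L ((freeInv ι K L).map (RingQuot.mkAlgHom K (GenRel q odd))),
    invOn_of_principal_mul ?_ ?_⟩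
  · rw [principal_extendZero]
    refine (hentry _ _).symm.trans (Eq.trans ?_ hone)
    ext a b
    exact RingQuot.mkAlgHom_rel K (GenRel.mul_inv L a b)
  · rw [principal_extendZero]
    refine (hentry _ _).symm.trans (Eq.trans ?_ hone)
    ext a b
    exact RingQuot.mkAlgHom_rel K (GenRel.inv_mul L a b)

/-- The universal property of the generic algebra, on minor Berezinians. -/
theorem IsQSuperManin.exists_algHom {M : Matrix ι ι A} (hM : IsQSuperManin q odd M)
    (hinv : ∀ L : Finset ι, ∃ N, InvOn L M N) :
    ∃ φ : GenericAlgebra q odd →ₐ[K] A,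
      ∀ L, φ (berMinor q odd (genericMatrix q odd) L) = berMinor q odd M L := by
  choose N hN using hinv
  let g : Gen ι → A := fun
    | .entry i j => M i j
    | .inv J a b => N J a b
  let F : FreeAlgebra K (Gen ι) →ₐ[K] A := FreeAlgebra.lift K g
  have hF : ∀ i j, F (freeMatrix ι K i j) = M i j := fun i j => FreeAlgebra.lift_ι_apply _ _
  have hFinv : ∀ (J : Finset ι) (a b : J), F (freeInv ι K J a b) = N J a b :=
    fun J a b => FreeAlgebra.lift_ι_apply _ _
  have hrel : ∀ ⦃x y⦄, GenRel q odd x y → F x = F y := by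
    intro x y h
    cases h with
    | sq i j hi hj => simpa [hF] using hM.sq_eq_zero i j hi hj
    | row i k l hi => simpa only [map_mul, map_smul, hF] using hM.row i k l hi
    | col i j k hk => simpa only [map_mul, map_smul, hF] using hM.col i j k hk
    | cross i j k l => simpa only [map_mul, map_smul, map_sub, hF] using hM.cross i j k l
    | mul_inv J a b =>
      rw [Matrix.mul_apply, map_sum, Matrix.one_apply]
      refine (Finset.sum_congr rfl fun l _ => ?_).trans
        (congrFun (congrFun (hN J).principal_mul.1 a) b |>.trans ?_)
      · rw [map_mul, hFinv]
        exact congrArg (· * _) (hF _ _)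
      · rw [Matrix.one_apply]
        split_ifs <;> simp
    | inv_mul J a b =>
      rw [Matrix.mul_apply, map_sum, Matrix.one_apply]
      refine (Finset.sum_congr rfl fun l _ => ?_).trans
        (congrFun (congrFun (hN J).principal_mul.2 a) b |>.trans ?_)
      · rw [map_mul, hFinv]
        exact congrArg (_ * ·) (hF _ _)
      · rw [Matrix.one_apply]
        split_ifs <;> simp
  refine ⟨RingQuot.liftAlgHom K ⟨F, hrel⟩, fun L => ?_⟩
  obtain ⟨W, hW⟩ := exists_invOn_genericMatrix q odd L
  rw [hW.map_berMinor]
  congr 1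
  ext i j
  rw [Matrix.map_apply, genericMatrix, RingQuot.liftAlgHom_mkAlgHom_apply, hF]

/-- Berezinians over a set containing all even indices factor through the Schur complement `S` of
`M_{Iᶜ}`: the even determinant and the pivots of the odd indices outside `I` do not depend on `J`,
and together they form the Berezinian of `M_{Iᶜ}`. -/
theorem IsCrossManin.exists_schur_berMinor [Fintype ι] (hq : q ≠ 0) (h2 : (2 : K) ≠ 0)
    {M : Matrix ι ι A} (hM : IsCrossManin q odd M) (hinv : ∀ L : Finset ι, ∃ N, InvOn L M N)
    {I : Finset ι} (hI : ∀ i ∈ I, odd i = true) :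
    ∃ (B : Aˣ) (S : Matrix ι ι A), (B : A) = berMinor q odd M Iᶜ ∧ IsCrossManin q odd S ∧
      ∀ J ⊆ I, (∃ N, InvOn J S N) ∧
        berMinor q odd M (J ∪ Iᶜ) = B * berMinor q odd S J := by
  classical
  -- the even indices, the odd indices, and the odd indices outside `I`
  set E : Finset ι := univ.filter fun i => odd i = false with hE
  set O : Finset ι := univ.filter fun i => odd i = true with hO
  set U : Finset ι := Iᶜ.filter fun i => odd i = true with hU
  have hOodd : ∀ i ∈ O, odd i = true := fun i hi => (mem_filter.mp hi).2
  have hIsub : I ⊆ O := fun i hi => by simp [hO, hI i hi]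
  have hUO : U ⊆ O := fun i hi => by simp [hO, (mem_filter.mp hi).2]
  have hUE : U ∪ E = Iᶜ := by
    ext i
    have hi := hI i
    cases h : odd i <;> simp only [h] at hi <;> (simp [hU, hE, h]; try tauto)
  have hOE : ∀ L ⊆ O, Disjoint L E := by
    intro L hL
    rw [disjoint_left]
    intro i hi hiE
    have h1 := hOodd i (hL hi)
    rw [(mem_filter.mp hiE).2] at h1
    exact Bool.noConfusion h1
  have hIU : ∀ J ⊆ I, Disjoint J U := by
    intro J hJ
    rw [disjoint_left]
    intro i hi hiU
    exact mem_compl.mp (mem_filter.mp hiU).1 (hJ hi)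
  obtain ⟨T, hT, hTinv⟩ := hM.exists_schur hq h2 hinv E
  have hTex : ∀ L ⊆ O, ∃ N, InvOn L T N := fun L hL =>
    let ⟨N, hN⟩ := hinv (L ∪ E)
    ⟨N, hTinv L N (hOE L hL) hN⟩
  obtain ⟨S, p, hS, hp, hSL⟩ := hT.exists_schur_rdet hq h2 hOodd hTex U hUO
  have hunit : ∀ L ⊆ O, IsUnit (rdet (-q) L T) := by
    intro L hL
    obtain ⟨S', p', -, hp', h⟩ := hT.exists_schur_rdet hq h2 hOodd hTex L hL
    have h0 := (h ∅ (by simp) (by simp)).2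
    rw [empty_union, rdet_empty, one_mul] at h0
    rwa [h0]
  have hD : IsUnit (rdet (-q)⁻¹ E M.transpose) :=
    hM.isUnit_rdet_transpose hq h2 E (fun i hi => (mem_filter.mp hi).2) fun L _ => hinv L
  have hber : ∀ J ⊆ I, ∀ N, InvOn (J ∪ Iᶜ) M N → berMinor q odd M (J ∪ Iᶜ) =
      rdet (-q)⁻¹ E M.transpose * rdet (-q)⁻¹ (J ∪ U) N := by
    intro J hJ N hN
    have h1 : (J ∪ Iᶜ).filter (fun i => odd i = false) = E := by
      ext i
      have hi := hI i
      have hi' := @hJ i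
      cases h : odd i <;> simp only [h] at hi <;> (simp [hE, h]; try tauto)
    have h3 : (J ∪ Iᶜ).filter (fun i => odd i = true) = J ∪ U := by
      rw [filter_union, filter_true_of_mem fun i hi => hI i (hJ hi)]
    rw [hN.berMinor_eq, h1, h3]
  have hTN : ∀ J ⊆ I, ∀ N, InvOn (J ∪ Iᶜ) M N → InvOn (J ∪ U) T N := by
    intro J hJ N hN
    refine hTinv _ N (hOE _ (union_subset (hJ.trans hIsub) hUO)) ?_
    rwa [union_assoc, hUE]
  -- a left inverse of an invertible element is its inverse
  have hinvT : ∀ J ⊆ I, ∀ N, InvOn (J ∪ Iᶜ) M N →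
      rdet (-q) (J ∪ U) T * rdet (-q)⁻¹ (J ∪ U) N = 1 := by
    intro J hJ N hN
    have hsub := union_subset (hJ.trans hIsub) hUO
    have h := rdet_inv_mul_rdet hq h2 (hT.isRowManin fun i hi => hOodd i (hsub hi))
      (hTN J hJ N hN).2
    obtain ⟨u, hu⟩ := hunit _ hsub
    rw [← hu] at h ⊢
    rw [← Units.inv_eq_of_mul_eq_one_left h, Units.mul_inv]
  obtain ⟨u, rfl⟩ := hp
  obtain ⟨N₀, hN₀⟩ := hinv Iᶜ
  rw [← empty_union Iᶜ] at hN₀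
  have h0 := hinvT ∅ (by simp) N₀ hN₀
  rw [(hSL ∅ (by simp) (by simp)).2, rdet_empty, one_mul] at h0
  obtain ⟨d, hd⟩ := hD
  refine ⟨d * u⁻¹, S, ?_, hS, fun J hJ => ?_⟩
  · have h1 := hber ∅ (by simp) N₀ hN₀
    rw [empty_union] at h1
    rw [h1, ← hd, Units.val_mul, ← Units.inv_eq_of_mul_eq_one_right h0]
  · obtain ⟨N, hN⟩ := hinv (J ∪ Iᶜ)
    have hSN : InvOn J S N := (hSL J (hJ.trans hIsub) (hIU J hJ)).1 N (hTN J hJ N hN)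
    refine ⟨⟨N, hSN⟩, ?_⟩
    rw [hSN.berMinor_of_odd fun i hi => hI i (hJ hi), hber J hJ N hN, ← hd, Units.val_mul,
      mul_assoc]
    congr 1
    have h1 := hinvT J hJ N hN
    rw [(hSL J (hJ.trans hIsub) (hIU J hJ)).2, mul_assoc] at h1
    have h3 := rdet_inv_mul_rdet hq h2 (hS.isRowManin fun i hi => hI i (hJ hi)) hSN.2
    rw [Units.eq_inv_mul_iff_mul_eq]
    calc (u : A) * rdet (-q)⁻¹ (J ∪ U) N
        = rdet (-q)⁻¹ J N * rdet (-q) J S * (u * rdet (-q)⁻¹ (J ∪ U) N) := by rw [h3, one_mul]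
      _ = rdet (-q)⁻¹ J N := by rw [mul_assoc, h1, mul_one]

end Berezinian

/-! ### Diagonal extensions -/

section BlockSum

variable {ι K A : Type*} [LinearOrder ι] [Field K] [Ring A] [Algebra K A] {q : K} {odd : ι → Bool}

/-- A matrix stays Manin on adding a diagonal whose entries commute with each other and `q`-commute
with the given entries, according to the positions of the indices. -/
theorem IsCrossManin.add_diagonal (hq : q ≠ 0) {X : Matrix ι ι A} (hX : IsCrossManin q odd X)
    {d : ι → A} (hd : ∀ a b, d a * d b = d b * d a)
    (hdX : ∀ a k l, d a * X k l = q ^ (eps a k + eps l a) • (X k l * d a)) :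
    IsCrossManin q odd (X + Matrix.diagonal d) := by
  intro i j k l
  have hXd : ∀ a k l, X k l * d a = q ^ (eps k a + eps a l) • (d a * X k l) := by
    intro a k l
    rw [hdX, smul_smul, ← zpow_add₀ hq, eps_swap a k, eps_swap l a,
      show -eps a k + -eps l a + (eps a k + eps l a) = 0 by ring, zpow_zero, one_smul]
  have hsign : ∀ n : ℕ, (-1 : K) ^ ((n + n) : ℕ) = 1 := fun n => by simp [← two_mul]
  have h1 := hX i j k l
  have e1 : Matrix.diagonal d i j * X k l = (q ^ (eps i k + eps l j) *
      (-1) ^ ((par odd i + par odd j) * (par odd k + par odd l))) •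
        (X k l * Matrix.diagonal d i j) := by
    by_cases h : i = j
    · subst h
      rw [Matrix.diagonal_apply_eq, hdX, add_mul, hsign, mul_one]
    · simp [Matrix.diagonal_apply_ne _ h]
  have e2 : X i j * Matrix.diagonal d k l = (q ^ (eps i k + eps l j) *
      (-1) ^ ((par odd i + par odd j) * (par odd k + par odd l))) •
        (Matrix.diagonal d k l * X i j) := by
    by_cases h : k = l
    · subst h
      rw [Matrix.diagonal_apply_eq, hXd, mul_add, hsign, mul_one]
    · simp [Matrix.diagonal_apply_ne _ h]
  have e3 : (q ^ eps i k *
      (-1) ^ (par odd i * par odd k + par odd j * par odd k + par odd i * par odd j)) •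
        (X k j * Matrix.diagonal d i l) = (q ^ eps l j *
      (-1) ^ (par odd j * par odd k + par odd j * par odd l + par odd k * par odd l)) •
        (Matrix.diagonal d i l * X k j) := by
    by_cases h : i = l
    · subst h
      rw [Matrix.diagonal_apply_eq, hdX, smul_smul, zpow_add₀ hq, eps_swap i j, zpow_neg]
      have := zpow_ne_zero (eps i j) hq
      congr 1
      field_simp
      ring
    · simp [Matrix.diagonal_apply_ne _ h]
  have e4 : (q ^ eps i k *
      (-1) ^ (par odd i * par odd k + par odd j * par odd k + par odd i * par odd j)) •
        (Matrix.diagonal d k j * X i l) = (q ^ eps l j *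
      (-1) ^ (par odd j * par odd k + par odd j * par odd l + par odd k * par odd l)) •
        (X i l * Matrix.diagonal d k j) := by
    by_cases h : k = j
    · subst h
      rw [Matrix.diagonal_apply_eq, hdX, smul_smul, zpow_add₀ hq, eps_swap i k, zpow_neg]
      have := zpow_ne_zero (eps i k) hq
      congr 1
      field_simp
      rcases par_eq_zero_or_one (odd := odd) k with hk | hk <;>
        rcases par_eq_zero_or_one (odd := odd) i with hi | hi <;>
        rcases par_eq_zero_or_one (odd := odd) l with hl | hl <;> norm_num [hk, hi, hl]
    · simp [Matrix.diagonal_apply_ne _ h]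
  have e5 : Matrix.diagonal d i j * Matrix.diagonal d k l = (q ^ (eps i k + eps l j) *
      (-1) ^ ((par odd i + par odd j) * (par odd k + par odd l))) •
        (Matrix.diagonal d k l * Matrix.diagonal d i j) := by
    by_cases h : i = j
    · by_cases h' : k = l
      · subst h; subst h'
        rw [eps_swap i k, add_neg_cancel, zpow_zero, add_mul, hsign, mul_one, one_smul]
        simp [hd i k]
      · simp [Matrix.diagonal_apply_ne _ h']
    · simp [Matrix.diagonal_apply_ne _ h]
  have e6 : (q ^ eps i k *
      (-1) ^ (par odd i * par odd k + par odd j * par odd k + par odd i * par odd j)) •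
        (Matrix.diagonal d k j * Matrix.diagonal d i l) = (q ^ eps l j *
      (-1) ^ (par odd j * par odd k + par odd j * par odd l + par odd k * par odd l)) •
        (Matrix.diagonal d i l * Matrix.diagonal d k j) := by
    by_cases h : k = j
    · by_cases h' : i = l
      · subst h; subst h'
        rw [Matrix.diagonal_apply_eq, Matrix.diagonal_apply_eq, hd k i]
        congr 2
        ring
      · simp [Matrix.diagonal_apply_ne _ h']
    · simp [Matrix.diagonal_apply_ne _ h]
  simp only [Matrix.add_apply, mul_add, add_mul]
  linear_combination (norm := module) h1 + e1 + e2 + e5 - e3 - e4 - e6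

/-- If `X` and `Y` are supported on `I` and inverse to each other on `J ∩ I`, and the diagonals `d`
and `e` are supported outside `I` and inverse to each other there, then `X + d` and `Y + e` are
inverse to each other on `J`. -/
theorem sum_add_diagonal_mul {I J : Finset ι} {X Y : Matrix ι ι A} {d e : ι → A}
    (hX : ∀ i j, ¬ (i ∈ I ∧ j ∈ I) → X i j = 0) (hY : ∀ i j, ¬ (i ∈ I ∧ j ∈ I) → Y i j = 0)
    (hd : ∀ a ∈ I, d a = 0) (he : ∀ a ∈ I, e a = 0) (hde : ∀ a ∉ I, d a * e a = 1)
    (h : ∀ i ∈ J ∩ I, ∀ j ∈ J ∩ I, ∑ l ∈ J ∩ I, X i l * Y l j = if i = j then 1 else 0) :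
    ∀ i ∈ J, ∀ j ∈ J, ∑ l ∈ J, (X + Matrix.diagonal d) i l * (Y + Matrix.diagonal e) l j =
      if i = j then 1 else 0 := by
  intro i hi j hj
  have hXe : X i j * e j = 0 := by
    by_cases hjI : j ∈ I
    · rw [he j hjI, mul_zero]
    · rw [hX i j fun h => hjI h.2, zero_mul]
  have hdY : d i * Y i j = 0 := by
    by_cases hiI : i ∈ I
    · rw [hd i hiI, zero_mul]
    · rw [hY i j fun h => hiI h.1, mul_zero]
  have hsum : ∑ l ∈ J, (X + Matrix.diagonal d) i l * (Y + Matrix.diagonal e) l j =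
      ∑ l ∈ J, X i l * Y l j + X i j * e j + (d i * Y i j + if i = j then d i * e i else 0) := by
    simp only [Matrix.add_apply, add_mul, mul_add, sum_add_distrib, Matrix.diagonal_apply,
      ite_mul, zero_mul, mul_ite, mul_zero, sum_ite_eq, sum_ite_eq', hi, hj, if_true]
    split_ifs with hij
    · subst hij; abel
    · abel
  have hXY : ∑ l ∈ J, X i l * Y l j = ∑ l ∈ J ∩ I, X i l * Y l j := by
    symm
    refine sum_subset inter_subset_left fun l hl hl' => ?_
    rw [hX i l fun h => hl' (mem_inter.mpr ⟨hl, h.2⟩), zero_mul]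
  rw [hsum, hXe, hdY, add_zero, zero_add, hXY]
  by_cases hiI : i ∈ I
  · rw [hd i hiI, zero_mul, ite_self, add_zero]
    by_cases hjI : j ∈ I
    · exact h i (mem_inter.mpr ⟨hi, hiI⟩) j (mem_inter.mpr ⟨hj, hjI⟩)
    · rw [if_neg fun h : i = j => hjI (h ▸ hiI)]
      exact sum_eq_zero fun l _ => by rw [hY l j fun h => hjI h.2, mul_zero]
  · rw [hde i hiI]
    rw [sum_eq_zero fun l _ => by rw [hX i l fun h => hiI h.1, zero_mul], zero_add]

end BlockSum

/-! ### Twisting by a quantum torus -/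

section Torus

variable {ι K A : Type*} [Field K] [Ring A] [Algebra K A]

/-- Translation by `g` on functions on the lattice. -/
def shift (K A : Type*) {ι : Type*} [Field K] [Ring A] [Algebra K A] :
    Multiplicative (ι → ℤ) →* Module.End K ((ι → ℤ) → A) where
  toFun g := LinearMap.funLeft K A fun n => n + g.toAdd
  map_one' := by
    refine LinearMap.ext fun f => funext fun n => ?_
    simp [LinearMap.funLeft_apply]
  map_mul' g h := by
    refine LinearMap.ext fun f => funext fun n => ?_
    simp [LinearMap.funLeft_apply, add_assoc]

theorem shift_apply (g : Multiplicative (ι → ℤ)) (f : (ι → ℤ) → A) (n : ι → ℤ) :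
    shift K A g f n = f (n + g.toAdd) := rfl

/-- Multiplication by the character `n ↦ c ^ n_a` of the lattice. -/
def phase (A : Type*) [Ring A] [Algebra K A] (c : K) (a : ι) : Module.End K ((ι → ℤ) → A) where
  toFun f n := c ^ n a • f n
  map_add' f g := by funext n; simp
  map_smul' s f := by funext n; simp [smul_comm s]

theorem phase_apply (c : K) (a : ι) (f : (ι → ℤ) → A) (n : ι → ℤ) :
    phase A c a f n = c ^ n a • f n := rfl

theorem phase_comm (c : K) (a b : ι) : phase A c a * phase A c b = phase A c b * phase A c a := by
  refine LinearMap.ext fun f => funext fun n => ?_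
  simp only [Module.End.mul_apply, phase_apply, smul_smul, mul_comm]

theorem phase_mul_phase_inv {c : K} (hc : c ≠ 0) (a : ι) : phase A c a * phase A c⁻¹ a = 1 := by
  refine LinearMap.ext fun f => funext fun n => ?_
  simp only [Module.End.mul_apply, phase_apply, smul_smul, inv_zpow]
  rw [mul_inv_cancel₀ (zpow_ne_zero _ hc), one_smul, Module.End.one_apply]

/-- Left multiplication by elements of `A` on functions on the lattice. -/
def coeff (K A ι : Type*) [Field K] [Ring A] [Algebra K A] :
    A →ₐ[K] Module.End K ((ι → ℤ) → A) :=
  Algebra.lsmul K K ((ι → ℤ) → A)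

theorem coeff_apply (x : A) (f : (ι → ℤ) → A) (n : ι → ℤ) : coeff K A ι x f n = x * f n := rfl

theorem coeff_injective : Function.Injective (coeff K A ι) := by
  intro x y h
  have := congrFun (LinearMap.congr_fun h fun _ => 1) 0
  simpa [coeff_apply] using this

theorem commute_coeff_shift (x : A) (g : Multiplicative (ι → ℤ)) :
    Commute (coeff K A ι x) (shift K A g) :=
  LinearMap.ext fun _ => rfl

variable [LinearOrder ι]

/-- The lattice vector attached to the index `k`: translating by it turns the phase of `a` into
its multiple by `q ^ (-ε(a - k))`. -/
def weight (k : ι) : ι → ℤ := fun a => -eps a k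

/-- The matrix `T` conjugated by translations by the weights. -/
def torusTwist (K : Type*) [Field K] [Algebra K A] (T : Matrix ι ι A) :
    Matrix ι ι (Module.End K ((ι → ℤ) → A)) :=
  fun i j => coeff K A ι (T i j) * shift K A (Multiplicative.ofAdd (weight i - weight j))

theorem torusTwist_mul_torusTwist (T T' : Matrix ι ι A) (i j k l : ι) :
    torusTwist K T i j * torusTwist K T' k l = coeff K A ι (T i j * T' k l) *
      shift K A (Multiplicative.ofAdd (weight i + weight k - weight j - weight l)) := by
  rw [torusTwist, torusTwist, mul_assoc, ← mul_assoc (shift K A _), ← (commute_coeff_shift _ _).eq,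
    mul_assoc, ← mul_assoc, ← map_mul, ← map_mul, ← ofAdd_add,
    show weight i - weight j + (weight k - weight l) = weight i + weight k - weight j - weight l by
      abel]

theorem torusTwist_eq_zero {T : Matrix ι ι A} {i j : ι} (h : T i j = 0) :
    torusTwist K T i j = 0 := by
  rw [torusTwist, h, map_zero, zero_mul]

theorem phase_mul_torusTwist {q : K} (hq : q ≠ 0) (T : Matrix ι ι A) (a k l : ι) :
    phase A q a * torusTwist K T k l =
      q ^ (eps a k + eps l a) • (torusTwist K T k l * phase A q a) := by
  refine LinearMap.ext fun f => funext fun n => ?_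
  simp only [torusTwist, Module.End.mul_apply, LinearMap.smul_apply, Pi.smul_apply, phase_apply,
    coeff_apply, shift_apply, toAdd_ofAdd, Pi.add_apply, Pi.sub_apply, weight, mul_smul_comm,
    smul_smul, ← zpow_add₀ hq, eps_swap a l]
  congr 2
  ring

theorem IsCrossManin.torusTwist {q : K} {odd : ι → Bool} {T : Matrix ι ι A}
    (hT : IsCrossManin q odd T) :
    IsCrossManin q odd (QSuper.torusTwist K T) := by
  intro i j k l
  have h := congrArg (fun z => coeff K A ι z *
    shift K A (Multiplicative.ofAdd (weight i + weight k - weight j - weight l))) (hT i j k l)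
  have h1 : weight k + weight i - weight l - weight j = weight i + weight k - weight j - weight l :=
    by abel
  have h2 : weight k + weight i - weight j - weight l = weight i + weight k - weight j - weight l :=
    by abel
  have h3 : weight i + weight k - weight l - weight j = weight i + weight k - weight j - weight l :=
    by abel
  simpa only [torusTwist_mul_torusTwist, h1, h2, h3, map_sub, map_smul, sub_mul,
    smul_mul_assoc] using h

theorem InvOn.torusTwist {L : Finset ι} {T N : Matrix ι ι A} (h : InvOn L T N) :
    InvOn L (QSuper.torusTwist K T) (QSuper.torusTwist K N) := by
  have key : ∀ T N : Matrix ι ι A, ∀ i j, (∑ l ∈ L, T i l * N l j = if i = j then 1 else 0) →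
      ∑ l ∈ L, QSuper.torusTwist K T i l * QSuper.torusTwist K N l j = if i = j then 1 else 0 := by
    intro T N i j h
    have hl : ∀ l ∈ L, QSuper.torusTwist K T i l * QSuper.torusTwist K N l j =
        coeff K A ι (T i l * N l j) * shift K A (Multiplicative.ofAdd (weight i - weight j)) := by
      intro l _
      rw [torusTwist_mul_torusTwist]
      congr 3
      abel
    rw [sum_congr rfl hl, ← sum_mul, ← map_sum, h]
    split_ifs with hij
    · rw [hij, sub_self, map_one, ofAdd_zero, map_one, one_mul]
    · rw [map_zero, zero_mul]
  exact ⟨fun i hi j hj => key _ _ i j (h.1 i hi j hj), fun i hi j hj => key _ _ i j (h.2 i hi j hj)⟩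

theorem orderedProd_eq_prod {α B : Type*} [LinearOrder α] [Fintype α] [CommMonoid B] (f : α → B) :
    orderedProd f = ∏ a, f a := by
  rw [orderedProd, ← List.prod_toFinset f (Finset.sort_nodup _ _), Finset.sort_toFinset]

/-- The translations cancel in determinants of principal submatrices. -/
theorem rdet_torusTwist (t : K) (U : Finset ι) (T : Matrix ι ι A) :
    rdet t U (torusTwist K T) = coeff K A ι (rdet t U T) := by
  rw [rdet, rdet, map_sum]
  refine Finset.sum_congr rfl fun σ _ => ?_
  rw [map_smul]
  congr 1
  simp only [torusTwist]
  rw [orderedProd_mul _ _ fun a b => commute_coeff_shift _ _, ← map_orderedProd (shift K A),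
    orderedProd_eq_prod, ← ofAdd_sum, sum_sub_distrib, Equiv.sum_comp σ fun a : U => weight a.1,
    sub_self, ofAdd_zero, map_one, mul_one]
  exact (map_orderedProd ((coeff K A ι : A →ₐ[K] _) : A →* Module.End K ((ι → ℤ) → A)) _).symm

/-- If the principal submatrices of `S` inside a set `I` of odd indices are invertible, then the block
of `S` on `I` becomes, after a twist by translations, a block of a matrix all of whose principal
submatrices are invertible; so its Berezinians inherit the identities between generic ones. -/
theorem IsCrossManin.exists_algHom_generic {q : K} {odd : ι → Bool} (hq : q ≠ 0)
    (h2 : (2 : K) ≠ 0) {S : Matrix ι ι A} (hS : IsCrossManin q odd S) {I : Finset ι}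
    (hI : ∀ i ∈ I, odd i = true) (hinv : ∀ L ⊆ I, ∃ N, InvOn L S N) :
    ∃ φ : GenericAlgebra q odd →ₐ[K] Module.End K ((ι → ℤ) → A), ∀ J ⊆ I,
      φ (berMinor q odd (genericMatrix q odd) J) = coeff K A ι (berMinor q odd S J) := by
  -- the block on `I`; on the complement, the phases make up a diagonal with the right commutation
  let res : Matrix ι ι A → Matrix ι ι A := fun T i j => if i ∈ I ∧ j ∈ I then T i j else 0
  have hres : ∀ T i j, ¬ (i ∈ I ∧ j ∈ I) → QSuper.torusTwist K (res T) i j = 0 := fun T i j h =>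
    torusTwist_eq_zero (if_neg h)
  have hresin : ∀ (T : Matrix ι ι A) {i j}, i ∈ I → j ∈ I → res T i j = T i j :=
    fun T i j hi hj => if_pos ⟨hi, hj⟩
  let d : K → ι → Module.End K ((ι → ℤ) → A) := fun c a => if a ∈ I then 0 else phase A c a
  have hcross : IsCrossManin q odd (res S) := by
    intro i j k l
    by_cases h : i ∈ I ∧ j ∈ I ∧ k ∈ I ∧ l ∈ I
    · obtain ⟨hi, hj, hk, hl⟩ := h
      rw [hresin S hi hj, hresin S hk hl, hresin S hk hj, hresin S hi hl]
      exact hS i j k l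
    · have h1 : res S i j * res S k l = 0 ∧ res S k l * res S i j = 0 ∧
          res S k j * res S i l = 0 ∧ res S i l * res S k j = 0 := by
        simp only [res]
        refine ⟨?_, ?_, ?_, ?_⟩ <;> split_ifs <;> first | simp | tauto
      rw [h1.1, h1.2.1, h1.2.2.1, h1.2.2.2]
      simp
  set X : Matrix ι ι (Module.End K ((ι → ℤ) → A)) :=
    QSuper.torusTwist K (res S) + Matrix.diagonal (d q)
  have hX : IsCrossManin q odd X := by
    refine hcross.torusTwist.add_diagonal hq ?_ ?_
    · intro a b
      by_cases ha : a ∈ I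
      · simp [d, ha]
      · by_cases hb : b ∈ I
        · simp [d, hb]
        · simpa [d, ha, hb] using phase_comm q a b
    · intro a k l
      by_cases ha : a ∈ I
      · simp [d, ha]
      · simpa [d, ha] using phase_mul_torusTwist hq (res S) a k l
  have hd0 : ∀ c, ∀ a ∈ I, d c a = 0 := fun c a ha => if_pos ha
  have hde : ∀ a ∉ I, d q a * d q⁻¹ a = 1 := by
    intro a ha
    simpa [d, ha] using phase_mul_phase_inv (A := A) hq a
  have hed : ∀ a ∉ I, d q⁻¹ a * d q a = 1 := by
    intro a ha
    simpa [d, ha] using phase_mul_phase_inv (A := A) (inv_ne_zero hq) a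
  have hXinv : ∀ L N, InvOn (L ∩ I) S N →
      InvOn L X (QSuper.torusTwist K (res N) + Matrix.diagonal (d q⁻¹)) := by
    intro L N hN
    have hresN : InvOn (L ∩ I) (res S) (res N) := by
      constructor
      · intro i hi j hj
        rw [← hN.1 i hi j hj]
        refine sum_congr rfl fun l hl => ?_
        rw [hresin S (mem_inter.mp hi).2 (mem_inter.mp hl).2,
          hresin N (mem_inter.mp hl).2 (mem_inter.mp hj).2]
      · intro i hi j hj
        rw [← hN.2 i hi j hj]
        refine sum_congr rfl fun l hl => ?_
        rw [hresin N (mem_inter.mp hi).2 (mem_inter.mp hl).2,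
          hresin S (mem_inter.mp hl).2 (mem_inter.mp hj).2]
    have ht := hresN.torusTwist (K := K)
    exact ⟨sum_add_diagonal_mul (hres S) (hres N) (hd0 q) (hd0 _) hde ht.1,
      sum_add_diagonal_mul (hres N) (hres S) (hd0 _) (hd0 q) hed ht.2⟩
  obtain ⟨φ, hφ⟩ := (hX.isQSuperManin h2).exists_algHom fun L =>
    let ⟨N, hN⟩ := hinv (L ∩ I) inter_subset_right
    ⟨_, hXinv L N hN⟩
  refine ⟨φ, fun J hJ => ?_⟩
  obtain ⟨N, hN⟩ := hinv J hJ
  have hJodd : ∀ i ∈ J, odd i = true := fun i hi => hI i (hJ hi)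
  rw [hφ, (hXinv J N (by rwa [inter_eq_left.mpr hJ])).berMinor_of_odd hJodd,
    hN.berMinor_of_odd hJodd, ← rdet_torusTwist]
  refine rdet_congr fun i hi j hj => ?_
  rw [Matrix.add_apply, QSuper.torusTwist, QSuper.torusTwist, hresin N (hJ hi) (hJ hj),
    Matrix.diagonal_apply,
    hd0 _ i (hJ hi), ite_self, add_zero]

end Torus

theorem prod_map_conj {A : Type*} [Monoid A] (u : Aˣ) (l : List A) :
    (l.map fun x => (u : A) * x * ((u⁻¹ : Aˣ) : A)).prod = u * l.prod * ((u⁻¹ : Aˣ) : A) := by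
  induction l with
  | nil => simp
  | cons x l ih =>
    rw [List.map_cons, List.prod_cons, List.prod_cons, ih]
    simp only [mul_assoc, Units.inv_mul_cancel_left]

end QSuper

theorem theorem4p9 (m n : ℕ) (I : Finset (Fin (m + n))) (hI : ∀ i ∈ I, m ≤ (i : ℕ))
    (k : ℕ) (b : Fin k → RatFunc ℂ) (r : Fin k → ℕ)
    (J : (i : Fin k) → Fin (r i) → Finset (Fin (m + n))) (hJ : ∀ i j, J i j ⊆ I)
    (hminor : ∑ i : Fin k, b i •
      (List.ofFn fun j : Fin (r i) =>
        QSuper.berMinor (RatFunc.X : RatFunc ℂ) (QSuper.oddIdx m n)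
          (QSuper.genericMatrix (RatFunc.X : RatFunc ℂ) (QSuper.oddIdx m n)) (J i j)).prod = 0)
    {A : Type*} [Ring A] [Algebra (RatFunc ℂ) A] (M : Matrix (Fin (m + n)) (Fin (m + n)) A)
    (hM : QSuper.IsQSuperManin (RatFunc.X : RatFunc ℂ) (QSuper.oddIdx m n) M)
    (hMinv : ∀ L : Finset (Fin (m + n)), IsUnit (QSuper.principal M L)) :
    ∃ B : Aˣ, (B : A) = QSuper.berMinor (RatFunc.X : RatFunc ℂ) (QSuper.oddIdx m n) M Iᶜ ∧
      ∑ i : Fin k, b i •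
        (List.ofFn fun j : Fin (r i) =>
          QSuper.berMinor (RatFunc.X : RatFunc ℂ) (QSuper.oddIdx m n) M (J i j ∪ Iᶜ) *
            ((B⁻¹ : Aˣ) : A)).prod = 0 := by
  have hq : (RatFunc.X : RatFunc ℂ) ≠ 0 := RatFunc.X_ne_zero
  have h2 : (2 : RatFunc ℂ) ≠ 0 := two_ne_zero
  have hodd : ∀ i ∈ I, QSuper.oddIdx m n i = true := fun i hi => decide_eq_true (hI i hi)
  obtain ⟨B, S, hB, hS, hBS⟩ := QSuper.IsCrossManin.exists_schur_berMinor hq h2 hM.cross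
    (fun L => QSuper.exists_invOn_of_isUnit (hMinv L)) hodd
  refine ⟨B, hB, ?_⟩
  obtain ⟨φ, hφ⟩ := hS.exists_algHom_generic hq h2 hodd fun L hL => (hBS L hL).1
  have hzero : ∑ i : Fin k, b i • (List.ofFn fun j : Fin (r i) =>
      QSuper.berMinor (RatFunc.X : RatFunc ℂ) (QSuper.oddIdx m n) S (J i j)).prod = 0 := by
    apply QSuper.coeff_injective (K := RatFunc ℂ) (ι := Fin (m + n))
    rw [map_zero, ← map_zero φ, ← hminor, map_sum, map_sum]
    refine Finset.sum_congr rfl fun i _ => ?_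
    rw [map_smul, map_smul, map_list_prod, map_list_prod, List.map_ofFn, List.map_ofFn]
    congr 3
    funext j
    exact (hφ (J i j) (hJ i j)).symm
  have hconj : ∀ i : Fin k, (List.ofFn fun j : Fin (r i) =>
      QSuper.berMinor (RatFunc.X : RatFunc ℂ) (QSuper.oddIdx m n) M (J i j ∪ Iᶜ) *
        ((B⁻¹ : Aˣ) : A)).prod = B * (List.ofFn fun j : Fin (r i) =>
      QSuper.berMinor (RatFunc.X : RatFunc ℂ) (QSuper.oddIdx m n) S (J i j)).prod *
        ((B⁻¹ : Aˣ) : A) := by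
    intro i
    rw [← QSuper.prod_map_conj, List.map_ofFn]
    congr 2
    funext j
    rw [(hBS (J i j) (hJ i j)).2]
    rfl
  have hfactor := congrArg (fun z => (B : A) * z * ((B⁻¹ : Aˣ) : A)) hzero
  simpa only [Finset.mul_sum, Finset.sum_mul, hconj, mul_smul_comm, smul_mul_assoc, mul_zero,
    zero_mul] using hfactor
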